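/- Let $\beta\in(1,2)$ and $\tau\in(0,\tfrac12)$, let $f:[0,1]^2\to[0,1]^2$ be given by $f(x,y)=(\beta x,\tau y)$ for $x\in[0,\beta^{-1}]$ and $f(x,y)=(\beta x-1,\tau y+(1-\tau))$ for $x\in(\beta^{-1},1]$, and let $\Lambda_{\beta,\tau}$ be the closure of $\bigcap_{i\ge0}f^i([0,1]^2)$. Let $\overline X_\beta$ be the two-sided $\beta$-shift, that is, the closure in $\{0,1\}^{\mathbb Z}$ of $X_\beta=\{(s_k):\sum_{k\ge1}s_{i-k}\beta^{-k}<1\text{ for all }i\in\mathbb Z\}$, with the shift $\sigma((s_k))=(s_{k-1})$, and let $\pi((s_k))=\bigl(\sum_{k\ge1}s_{-k}\beta^{-k},\ \sum_{k\ge0}s_k(1-\tau)\tau^k\bigr)$. Let $\mu_\beta$ be the Parry measure of $(\overline X_\beta,\sigma)$, that is, the $\sigma$-invariant probability measure for which $(s_{-1},s_{-2},\dots)$ is distributed as the greedy $\beta$-expansion of a point of $[0,1)$ chosen with the density proportional to $x\mapsto\sum_{n\ge0,\ x<T^n1}\beta^{-n}$, where $Tx=\beta x \bmod 1$ and $T^01=1$.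 Then $f(\Lambda_{\beta,\tau})\subseteq\Lambda_{\beta,\tau}$, and the system $(\Lambda_{\beta,\tau},f)$ has topological entropy (defined by open covers) equal to $\log\beta$. Moreover $\mu_\beta$ exists and is $\sigma$-ergodic with metric entropy $\log\beta$, and its projection $\nu_\beta=\mu_\beta\circ\pi^{-1}$ is a Borel probability measure on $\Lambda_{\beta,\tau}$ that is $f$-ergodic and has full entropy, $h(f|_{\Lambda_{\beta,\tau}},\nu_\beta)=\log\beta=h(f|_{\Lambda_{\beta,\tau}})$. -/

import Mathlib

open Set Filter Topology MeasureTheory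

namespace BetaAttractor

noncomputable section

/-! ### Topological entropy through open covers -/

section TopologicalEntropy

variable {X : Type*}

/-- The minimal number of elements of the family `U` that cover `X`. (Every family to which this is
applied below has a finite subfamily covering the space, since the space is compact.) -/
def coverNumber (U : Set (Set X)) : ℕ :=
  sInf {n : ℕ | ∃ F : Finset (Set X), (F : Set (Set X)) ⊆ U ∧ ⋃₀ (F : Set (Set X)) = univ ∧
    F.card = n}

/-- The common refinement `U ∨ T⁻¹ U ∨ ⋯ ∨ T⁻ⁿ U`. -/
def coverJoin (T : X → X) (U : Set (Set X)) (n : ℕ) : Set (Set X) :=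
  {W | ∃ c : Fin (n + 1) → Set X, (∀ i, c i ∈ U) ∧ W = ⋂ i : Fin (n + 1), T^[(i : ℕ)] ⁻¹' (c i)}

/-- The entropy `lim (1/n) log N(U ∨ T⁻¹ U ∨ ⋯ ∨ T⁻ⁿ U)` of `T` with respect to the cover `U`.
The limit exists by subadditivity and is written as a `limsup`. -/
def coverEntropyWrt (T : X → X) (U : Set (Set X)) : EReal :=
  limsup (fun n : ℕ => ((Real.log (coverNumber (coverJoin T U n)) / n : ℝ) : EReal)) atTop

/-- Topological entropy of a (not necessarily continuous) self-map of a compact space. -/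
def topologicalEntropy [TopologicalSpace X] (T : X → X) : EReal :=
  ⨆ (U : Set (Set X)) (_ : (∀ u ∈ U, IsOpen u) ∧ ⋃₀ U = univ), coverEntropyWrt T U

end TopologicalEntropy

/-! ### Metric entropy -/

section MetricEntropy

variable {X : Type*} [MeasurableSpace X]

/-- The entropy `- ∑ μ(P) log μ(P)` of the finite partition of `X` into the fibres of `p`. -/
def partitionEntropy {ι : Type*} [Fintype ι] (μ : Measure X) (p : X → ι) : ℝ :=
  ∑ a, Real.negMulLog (μ.real (p ⁻¹' {a}))

/-- The labelling whose fibres are the cells of `P ∨ T⁻¹ P ∨ ⋯ ∨ T⁻ⁿ P`, where `P` is the partition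
into the fibres of `p`. -/
def itinerary {ι : Type*} (T : X → X) (p : X → ι) (n : ℕ) : X → (Fin (n + 1) → ι) :=
  fun x i => p (T^[(i : ℕ)] x)

/-- The entropy `lim (1/n) H(μ, P ∨ T⁻¹ P ∨ ⋯ ∨ T⁻ⁿ P)`. The limit exists by subadditivity when
`T` preserves `μ`, and is written as a `limsup`. -/
def metricEntropyWrt {ι : Type*} [Fintype ι] (T : X → X) (μ : Measure X) (p : X → ι) : EReal :=
  limsup (fun n : ℕ => ((partitionEntropy μ (itinerary T p n) / n : ℝ) : EReal)) atTop

/-- Metric (Kolmogorov–Sinai) entropy: the supremum over all finite measurable partitions. -/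
def metricEntropy (T : X → X) (μ : Measure X) : EReal :=
  ⨆ (k : ℕ) (p : X → Fin k) (_ : Measurable p), metricEntropyWrt T μ p

end MetricEntropy

/-! ### The attractor -/

/-- The map `f`; only its values on the unit square matter, which it maps to itself. -/
def bakerMap (β τ : ℝ) (p : ℝ × ℝ) : ℝ × ℝ :=
  if p.1 ≤ β⁻¹ then (β * p.1, τ * p.2) else (β * p.1 - 1, τ * p.2 + (1 - τ))

/-- The attractor `Λ`, the closure of `⋂ fⁱ([0,1]²)`. -/
def attractor (β τ : ℝ) : Set (ℝ × ℝ) :=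
  closure (⋂ i : ℕ, (bakerMap β τ)^[i] '' (Icc (0 : ℝ) 1 ×ˢ Icc (0 : ℝ) 1))

/-! ### The two-sided β-shift -/

/-- The shift `(s_k) ↦ (s_{k-1})` on bi-infinite sequences. -/
def shift (s : ℤ → Fin 2) : ℤ → Fin 2 := fun k => s (k - 1)

/-- The set `X_β` of sequences with `∑_{k ≥ 1} s_{i-k} β^{-k} < 1` for all `i`. -/
def preBetaShift (β : ℝ) : Set (ℤ → Fin 2) :=
  {s | ∀ i : ℤ, ∑' k : ℕ, ((s (i - (k + 1)) : ℕ) : ℝ) * β⁻¹ ^ (k + 1) < 1}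

/-- The two-sided β-shift, the closure of `X_β`. -/
def betaShift (β : ℝ) : Set (ℤ → Fin 2) := closure (preBetaShift β)

theorem continuous_shift : Continuous shift :=
  continuous_pi fun k => continuous_apply (k - 1)

theorem mapsTo_shift_preBetaShift (β : ℝ) :
    MapsTo shift (preBetaShift β) (preBetaShift β) := by
  intro s hs i
  have h := hs (i - 1)
  have e : ∀ k : ℕ, i - 1 - ((k : ℤ) + 1) = i - ((k : ℤ) + 1) - 1 := fun k => by ring
  simpa only [shift, e] using h

theorem mapsTo_shift_betaShift (β : ℝ) : MapsTo shift (betaShift β) (betaShift β) :=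
  (mapsTo_shift_preBetaShift β).closure continuous_shift

/-- The shift on the two-sided β-shift. -/
def betaShiftMap (β : ℝ) : betaShift β → betaShift β :=
  (mapsTo_shift_betaShift β).restrict shift (betaShift β) (betaShift β)

/-- The coding map `π(s) = (∑_{k ≥ 1} s_{-k} β^{-k}, ∑_{k ≥ 0} s_k (1 - τ) τ^k)`. -/
def coding (β τ : ℝ) (s : ℤ → Fin 2) : ℝ × ℝ :=
  (∑' k : ℕ, ((s (-((k : ℤ) + 1)) : ℕ) : ℝ) * β⁻¹ ^ (k + 1),
    ∑' k : ℕ, ((s (k : ℤ) : ℕ) : ℝ) * (1 - τ) * τ ^ k)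

/-! ### The Parry measure -/

/-- The β-transformation `x ↦ β x mod 1`. -/
def betaMap (β x : ℝ) : ℝ := Int.fract (β * x)

/-- The digits `⌊β T^k x⌋`, `k ≥ 0`, of the greedy β-expansion of `x ∈ [0,1)`, for `1 < β < 2`. -/
def betaDigits (β x : ℝ) : ℕ → Fin 2 := fun k => if 1 ≤ β * (betaMap β)^[k] x then 1 else 0

/-- The measure on `[0,1)` with Parry's density `x ↦ ∑_{n ≥ 0, x < T^n 1} β^{-n}`,
before normalization. -/
def parryUnnormalized (β : ℝ) : Measure ℝ :=
  (volume.restrict (Ico (0 : ℝ) 1)).withDensity fun x =>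
    ∑' n : ℕ, if x < (betaMap β)^[n] 1 then ENNReal.ofReal (β⁻¹ ^ n) else 0

/-- Parry's invariant probability measure of the β-transformation on `[0,1)`. -/
def parryInterval (β : ℝ) : Measure ℝ :=
  (parryUnnormalized β univ)⁻¹ • parryUnnormalized β

/-- `μ` is the Parry measure of the two-sided β-shift: it is shift invariant, and the one-sided
sequence `(s_{-1}, s_{-2}, …)` is distributed as the greedy β-expansion of a point of `[0,1)` chosen
with Parry's invariant distribution. By invariance this prescribes the measure of every cylinder, so
there is at most one such measure. -/
structure IsParryMeasure (β : ℝ) (μ : Measure (betaShift β)) : Prop where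
  invariant : MeasurePreserving (betaShiftMap β) μ μ
  marginal : μ.map (fun s (k : ℕ) => s.1 (-((k : ℤ) + 1))) = (parryInterval β).map (betaDigits β)

end

end BetaAttractor

/-! The map expands horizontally by β and contracts vertically by τ, and the heights of the images
of its two branches lie in [0, τ] and [1 - τ, 1], which are disjoint because τ < 1/2. All entropy
therefore comes from the sequences of branches, that is, from β-expansions, and everything rests on
two estimates for words of length n.

Counting: at most C βⁿ words are read off along orbits in [0,1] (`exists_ncard_orbitWords_le`). A
word together with a rounded height locates an orbit segment in the attractor, so this bounds the
topological entropy above. The Parry measure is carried by such words, so it also bounds the metric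
entropy, once arbitrary partitions are approximated by cylinder partitions (`metricEntropyWrt_le`).

Expansion: the bottom edge of the square lies in the attractor, and an element of a refined
separating cover meets it in a set of diameter at most β⁻ⁿ, so βⁿ elements are needed
(`pow_le_card_of_cover`). Likewise Parry's density lies between 1 and ∑ β⁻ⁿ, so cylinders of length
n have mass at most a constant times β⁻ⁿ, which forces entropy at least log β.

The two-sided Parry measure is a weak limit of pushforwards of the invariant measure on [0,1)
(`exists_measure_map_past`). It is ergodic because the β-transformation is mixing up to a constant:
a cylinder is mapped onto an interval [0, b), which grows to cover [0,1).

The coding is a semiconjugacy off the null event x = β⁻¹, where the greedy digit and the branch of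
the map disagree. Ergodicity and the upper entropy bound pass to the image. The lower bound also
passes, because the branch partition pulls back to the time-zero partition; injectivity of the
coding is not needed. -/

namespace BetaAttractor

noncomputable section

/-! ### Entropy of finite partitions -/

section Entropy

variable {X : Type*} [MeasurableSpace X] {ι κ : Type*} [Fintype ι] [Fintype κ]

/-- The Gibbs inequality. -/
theorem sum_negMulLog_le_of_sum_le_one {r q : ι → ℝ} (hr : ∀ a, 0 ≤ r a) (hrs : ∑ a, r a = 1)
    (hq : ∀ a, 0 ≤ q a) (hqs : ∑ a, q a ≤ 1) (hrq : ∀ a, q a = 0 → r a = 0) :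
    ∑ a, Real.negMulLog (r a) ≤ ∑ a, -(r a * Real.log (q a)) := by
  have h : ∀ a, Real.negMulLog (r a) ≤ -(r a * Real.log (q a)) + (q a - r a) := by
    intro a
    rcases (hr a).eq_or_lt with h0 | h0
    · rw [← h0]; simpa using hq a
    · have hq0 : 0 < q a := lt_of_le_of_ne (hq a) fun h => h0.ne' (hrq a h.symm)
      have h1 := Real.log_le_sub_one_of_pos (div_pos hq0 h0)
      rw [Real.log_div hq0.ne' h0.ne'] at h1
      have h2 := mul_le_mul_of_nonneg_left h1 h0.le
      have h3 : r a * (q a / r a - 1) = q a - r a := by field_simp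
      rw [h3] at h2
      rw [Real.negMulLog]
      linarith
  calc ∑ a, Real.negMulLog (r a) ≤ ∑ a, (-(r a * Real.log (q a)) + (q a - r a)) :=
        Finset.sum_le_sum fun a _ => h a
    _ = ∑ a, -(r a * Real.log (q a)) + (∑ a, q a - 1) := by
        rw [Finset.sum_add_distrib, Finset.sum_sub_distrib, hrs]
    _ ≤ _ := by linarith

/-- Each r a is at most the total, so replacing log (r a) by the log of the total can only lower -r
a log (r a). This is why coarsening a partition does not raise its entropy. -/
theorem negMulLog_sum_le {α : Type*} (s : Finset α) {r : α → ℝ} (hr : ∀ a, 0 ≤ r a) :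
    Real.negMulLog (∑ a ∈ s, r a) ≤ ∑ a ∈ s, Real.negMulLog (r a) := by
  rw [Real.negMulLog, neg_mul, Finset.sum_mul, ← Finset.sum_neg_distrib]
  refine Finset.sum_le_sum fun a ha => ?_
  rcases (hr a).eq_or_lt with h0 | h0
  · simp [← h0]
  · have h1 : r a ≤ ∑ a ∈ s, r a := Finset.single_le_sum (fun b _ => hr b) ha
    have := mul_le_mul_of_nonneg_left (Real.log_le_log h0 h1) h0.le
    rw [Real.negMulLog]; linarith

theorem measurableSet_itinerary_preimage {T : X → X} (hT : Measurable T) {α : Type*} {p : X → α}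
    (hp : ∀ a, MeasurableSet (p ⁻¹' {a})) (n : ℕ) (c : Fin (n + 1) → α) :
    MeasurableSet (itinerary T p n ⁻¹' {c}) := by
  have : itinerary T p n ⁻¹' {c} = ⋂ i : Fin (n + 1), T^[(i : ℕ)] ⁻¹' (p ⁻¹' {c i}) := by
    ext x; simp [itinerary, funext_iff]
  rw [this]
  exact MeasurableSet.iInter fun i => hT.iterate _ (hp _)

variable {μ : Measure X}

theorem partitionEntropy_congr {p q : X → ι} (h : p =ᵐ[μ] q) :
    partitionEntropy μ p = partitionEntropy μ q := by
  refine Finset.sum_congr rfl fun a _ => ?_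
  congr 1
  refine measureReal_congr ?_
  filter_upwards [h] with x hx
  exact congrArg (· = a) hx

theorem partitionEntropy_comp_measurePreserving {Y : Type*} [MeasurableSpace Y] {μ' : Measure Y}
    {g : X → Y} (hg : MeasurePreserving g μ μ') {p : Y → ι}
    (hp : ∀ a, MeasurableSet (p ⁻¹' {a})) :
    partitionEntropy μ (p ∘ g) = partitionEntropy μ' p := by
  refine Finset.sum_congr rfl fun a _ => ?_
  rw [preimage_comp, hg.measureReal_preimage (hp a).nullMeasurableSet]

variable [IsProbabilityMeasure μ]

theorem measureReal_comp_preimage_singleton {α : Type*} [DecidableEq α] {p : X → ι}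
    (hp : ∀ a, MeasurableSet (p ⁻¹' {a})) (g : ι → α) (b : α) :
    μ.real ((g ∘ p) ⁻¹' {b}) = ∑ a with g a = b, μ.real (p ⁻¹' {a}) := by
  rw [← measureReal_biUnion_finset]
  · congr 1; ext x; simp
  · intro a _ a' _ h
    exact Disjoint.preimage p (by simpa using h)
  · exact fun a _ => hp a

theorem sum_measureReal_preimage_singleton {p : X → ι} (hp : ∀ a, MeasurableSet (p ⁻¹' {a})) :
    ∑ a, μ.real (p ⁻¹' {a}) = 1 := by
  classical
  have h := measureReal_comp_preimage_singleton (μ := μ) hp (fun _ => ()) ()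
  have e : ((fun _ => ()) ∘ p) ⁻¹' {()} = univ := by ext; simp
  rw [e, probReal_univ] at h
  simpa using h.symm

theorem partitionEntropy_comp_le {p : X → ι} (hp : ∀ a, MeasurableSet (p ⁻¹' {a})) (g : ι → κ) :
    partitionEntropy μ (g ∘ p) ≤ partitionEntropy μ p := by
  classical
  unfold partitionEntropy
  calc _ ≤ ∑ b, ∑ a with g a = b, Real.negMulLog (μ.real (p ⁻¹' {a})) := by
        refine Finset.sum_le_sum fun b _ => ?_
        rw [measureReal_comp_preimage_singleton hp]
        exact negMulLog_sum_le _ fun a => measureReal_nonneg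
    _ = _ := Finset.sum_fiberwise _ _ _

/-- Gibbs' inequality for the joint distribution against the product of its marginals; the resulting
cross entropy splits into the two marginal entropies. -/
theorem partitionEntropy_prod_le {p : X → ι} {q : X → κ} (hp : ∀ a, MeasurableSet (p ⁻¹' {a}))
    (hq : ∀ a, MeasurableSet (q ⁻¹' {a})) :
    partitionEntropy μ (fun x => (p x, q x)) ≤ partitionEntropy μ p + partitionEntropy μ q := by
  classical
  have hpq : ∀ a, MeasurableSet ((fun x => (p x, q x)) ⁻¹' {a}) := by
    rintro ⟨a, b⟩
    have : (fun x => (p x, q x)) ⁻¹' {(a, b)} = p ⁻¹' {a} ∩ q ⁻¹' {b} := by ext; simp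
    rw [this]; exact (hp a).inter (hq b)
  set r : ι × κ → ℝ := fun c => μ.real ((fun x => (p x, q x)) ⁻¹' {c}) with hr
  have hrp : ∀ c, r c ≤ μ.real (p ⁻¹' {c.1}) := fun c =>
    measureReal_mono (by rintro x rfl; simp) (measure_ne_top _ _)
  have hrq : ∀ c, r c ≤ μ.real (q ⁻¹' {c.2}) := fun c =>
    measureReal_mono (by rintro x rfl; simp) (measure_ne_top _ _)
  have hr0 : ∀ c, 0 ≤ r c := fun c => measureReal_nonneg
  have key := sum_negMulLog_le_of_sum_le_one (r := r)
    (q := fun c => μ.real (p ⁻¹' {c.1}) * μ.real (q ⁻¹' {c.2})) hr0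
    (sum_measureReal_preimage_singleton hpq) (fun c => by positivity)
    (by rw [Fintype.sum_prod_type]; dsimp only; rw [← Finset.sum_mul_sum,
          sum_measureReal_preimage_singleton hp, sum_measureReal_preimage_singleton hq]; simp)
    (fun c hc => by
      rcases mul_eq_zero.1 hc with h | h
      · exact le_antisymm (h ▸ hrp c) (hr0 c)
      · exact le_antisymm (h ▸ hrq c) (hr0 c))
  refine key.trans (le_of_eq ?_)
  have e1 : ∀ a, ∑ b, r (a, b) = μ.real (p ⁻¹' {a}) := by
    intro a
    have := measureReal_comp_preimage_singleton (μ := μ) hpq Prod.fst a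
    rw [show Prod.fst ∘ (fun x => (p x, q x)) = p from rfl] at this
    rw [this, Finset.sum_filter, Fintype.sum_prod_type, Finset.sum_eq_single a]
    · simp [hr]
    · intro b _ hb; simp [hb]
    · simp
  have e2 : ∀ b, ∑ a, r (a, b) = μ.real (q ⁻¹' {b}) := by
    intro a
    have := measureReal_comp_preimage_singleton (μ := μ) hpq Prod.snd a
    rw [show Prod.snd ∘ (fun x => (p x, q x)) = q from rfl] at this
    rw [this, Finset.sum_filter, Fintype.sum_prod_type_right, Finset.sum_eq_single a]
    · simp [hr]
    · intro b _ hb; simp [hb]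
    · simp
  have e3 : ∀ c : ι × κ, -(r c * Real.log (μ.real (p ⁻¹' {c.1}) * μ.real (q ⁻¹' {c.2}))) =
      -(r c * Real.log (μ.real (p ⁻¹' {c.1}))) + -(r c * Real.log (μ.real (q ⁻¹' {c.2}))) := by
    intro c
    rcases (hr0 c).eq_or_lt with h | h
    · simp [← h]
    · rw [Real.log_mul (h.trans_le (hrp c)).ne' (h.trans_le (hrq c)).ne']; ring
  simp_rw [e3]
  rw [Finset.sum_add_distrib, Fintype.sum_prod_type, Fintype.sum_prod_type_right]
  unfold partitionEntropy
  congr 1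
  · refine Finset.sum_congr rfl fun a _ => ?_
    simp only
    rw [Finset.sum_neg_distrib, ← Finset.sum_mul, e1, Real.negMulLog]; ring
  · refine Finset.sum_congr rfl fun a _ => ?_
    simp only
    rw [Finset.sum_neg_distrib, ← Finset.sum_mul, e2, Real.negMulLog]; ring

/-- Gibbs' inequality against the uniform distribution on `F`. -/
theorem partitionEntropy_le_log_card {p : X → ι} (hp : ∀ a, MeasurableSet (p ⁻¹' {a}))
    (F : Finset ι) (hF : ∀ᵐ x ∂μ, p x ∈ F) : partitionEntropy μ p ≤ Real.log F.card := by
  classical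
  have hr0 : ∀ a, a ∉ F → μ.real (p ⁻¹' {a}) = 0 := by
    intro a ha
    rw [measureReal_eq_zero_iff]
    refine measure_mono_null ?_ (ae_iff.1 hF)
    rintro x rfl; exact ha
  have hF0 : F.Nonempty := by
    obtain ⟨x, hx⟩ := hF.exists
    exact ⟨_, hx⟩
  have hc : (0 : ℝ) < F.card := by exact_mod_cast hF0.card_pos
  have key := sum_negMulLog_le_of_sum_le_one (r := fun a => μ.real (p ⁻¹' {a}))
    (q := fun a => if a ∈ F then (F.card : ℝ)⁻¹ else 0) (fun a => measureReal_nonneg)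
    (sum_measureReal_preimage_singleton hp) (fun a => by split_ifs <;> positivity)
    (by rw [Finset.sum_ite_mem, Finset.univ_inter, Finset.sum_const, nsmul_eq_mul,
          mul_inv_cancel₀ hc.ne'])
    (fun a ha => by
      by_cases h : a ∈ F
      · simp [h, hF0.ne_empty] at ha
      · exact hr0 a h)
  refine key.trans (le_of_eq ?_)
  have : ∀ a, -(μ.real (p ⁻¹' {a}) * Real.log (if a ∈ F then (F.card : ℝ)⁻¹ else 0)) =
      μ.real (p ⁻¹' {a}) * Real.log F.card := by
    intro a
    by_cases h : a ∈ F
    · simp [h]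
    · simp [hr0 a h]
  simp_rw [this]
  rw [← Finset.sum_mul, sum_measureReal_preimage_singleton hp, one_mul]

theorem neg_log_le_partitionEntropy {p : X → ι} (hp : ∀ a, MeasurableSet (p ⁻¹' {a})) {b : ℝ}
    (hb : ∀ a, μ.real (p ⁻¹' {a}) ≤ b) : -Real.log b ≤ partitionEntropy μ p := by
  calc -Real.log b = ∑ a, μ.real (p ⁻¹' {a}) * -Real.log b := by
        rw [← Finset.sum_mul, sum_measureReal_preimage_singleton hp, one_mul]
    _ ≤ _ := by
        refine Finset.sum_le_sum fun a _ => ?_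
        rcases (measureReal_nonneg (μ := μ) (s := p ⁻¹' {a})).eq_or_lt with h | h
        · simp [← h]
        · have := mul_le_mul_of_nonneg_left (Real.log_le_log h (hb a)) h.le
          rw [Real.negMulLog]; linarith

theorem partitionEntropy_itinerary_le {T : X → X} (hT : MeasurePreserving T μ μ) {p : X → ι}
    (hp : ∀ a, MeasurableSet (p ⁻¹' {a})) (n : ℕ) :
    partitionEntropy μ (itinerary T p n) ≤ (n + 1) * partitionEntropy μ p := by
  induction n with
  | zero =>
    have : itinerary T p 0 = (fun a (_ : Fin 1) => a) ∘ p := by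
      funext x i; simp [itinerary]
    rw [this]
    simpa using partitionEntropy_comp_le hp _
  | succ n ih =>
    have : itinerary T p (n + 1) = (fun c : (Fin (n + 1) → ι) × ι =>
        (Fin.snoc (α := fun _ => ι) c.1 c.2 : Fin (n + 2) → ι)) ∘
        (fun x => (itinerary T p n x, (p ∘ T^[n + 1]) x)) := by
      funext x i
      refine Fin.lastCases ?_ (fun j => ?_) i <;> simp [itinerary]
    have hp' : ∀ a, MeasurableSet ((p ∘ T^[n + 1]) ⁻¹' {a}) := fun a =>
      hT.measurable.iterate (n + 1) (hp a)
    have hi := measurableSet_itinerary_preimage hT.measurable hp n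
    rw [this]
    refine (partitionEntropy_comp_le ?_ _).trans ((partitionEntropy_prod_le hi hp').trans ?_)
    · rintro ⟨a, b⟩
      have : (fun x => (itinerary T p n x, (p ∘ T^[n + 1]) x)) ⁻¹' {(a, b)} =
        itinerary T p n ⁻¹' {a} ∩ (p ∘ T^[n + 1]) ⁻¹' {b} := by ext; simp
      rw [this]; exact (hi a).inter (hp' b)
    · rw [partitionEntropy_comp_measurePreserving (hT.iterate (n + 1)) hp]
      push_cast; linarith

/-- The symbol by which `p` differs from `q`, if it does. -/
def discrepancy [DecidableEq ι] (p q : X → ι) (x : X) : Option ι :=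
  if p x = q x then none else some (p x)

theorem measurableSet_discrepancy_preimage [DecidableEq ι] {p q : X → ι}
    (hp : ∀ a, MeasurableSet (p ⁻¹' {a})) (hq : ∀ a, MeasurableSet (q ⁻¹' {a})) (c : Option ι) :
    MeasurableSet (discrepancy p q ⁻¹' {c}) := by
  have hpq : MeasurableSet {x | p x = q x} := by
    have : {x | p x = q x} = ⋃ a, p ⁻¹' {a} ∩ q ⁻¹' {a} := by
      ext x; simp [eq_comm]
    rw [this]
    exact MeasurableSet.iUnion fun a => (hp a).inter (hq a)
  cases c with
  | none =>
    convert hpq using 1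
    ext x; simp [discrepancy]
  | some a =>
    have : discrepancy p q ⁻¹' {some a} = {x | p x = q x}ᶜ ∩ p ⁻¹' {a} := by
      ext x; simp [discrepancy]
    rw [this]; exact hpq.compl.inter (hp a)

/-- `p` can be reconstructed from `q` and the discrepancy, so its itinerary is a function of two
itineraries, and the second costs at most the entropy of the discrepancy per time step. This takes
the place of conditional entropy. -/
theorem partitionEntropy_itinerary_le_add [DecidableEq ι] {T : X → X}
    (hT : MeasurePreserving T μ μ) {p q : X → ι}
    (hp : ∀ a, MeasurableSet (p ⁻¹' {a})) (hq : ∀ a, MeasurableSet (q ⁻¹' {a})) (n : ℕ) :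
    partitionEntropy μ (itinerary T p n) ≤
      partitionEntropy μ (itinerary T q n) + (n + 1) * partitionEntropy μ (discrepancy p q) := by
  have hd := measurableSet_discrepancy_preimage hp hq
  have h1 := measurableSet_itinerary_preimage hT.measurable hq n
  have h2 := measurableSet_itinerary_preimage hT.measurable hd n
  have : itinerary T p n = (fun c : (Fin (n + 1) → ι) × (Fin (n + 1) → Option ι) =>
      fun i => (c.2 i).getD (c.1 i)) ∘
      (fun x => (itinerary T q n x, itinerary T (discrepancy p q) n x)) := by
    funext x i
    simp only [itinerary, discrepancy, Function.comp]
    split_ifs with h <;> simp [h]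
  rw [this]
  refine (partitionEntropy_comp_le ?_ _).trans ((partitionEntropy_prod_le h1 h2).trans ?_)
  · rintro ⟨a, b⟩
    have : (fun x => (itinerary T q n x, itinerary T (discrepancy p q) n x)) ⁻¹' {(a, b)} =
      itinerary T q n ⁻¹' {a} ∩ itinerary T (discrepancy p q) n ⁻¹' {b} := by ext; simp
    rw [this]; exact (h1 a).inter (h2 b)
  · gcongr
    exact partitionEntropy_itinerary_le hT hd n

/-- -t log t is continuous and vanishes at 0, which handles the `some` cells; for the `none` cell,
of mass near 1, it is at most 1 - t. The threshold does not depend on the measure. -/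
theorem exists_partitionEntropy_discrepancy_le [DecidableEq ι] {ε : ℝ} (hε : 0 < ε) :
    ∃ δ > 0, ∀ (μ : Measure X) [IsProbabilityMeasure μ] (p q : X → ι),
      (∀ a, MeasurableSet (p ⁻¹' {a})) → (∀ a, MeasurableSet (q ⁻¹' {a})) →
      μ.real {x | p x ≠ q x} ≤ δ → partitionEntropy μ (discrepancy p q) ≤ ε := by
  -- An equal share of ε for each of the |ι| + 1 values in `Option ι`.
  set ε' := ε / (Fintype.card ι + 1) with hε'
  have hε'0 : 0 < ε' := by positivity
  have hc := (Real.continuous_negMulLog.tendsto 0).eventually_lt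
    (tendsto_const_nhds (x := ε')) (by simpa)
  obtain ⟨δ, hδ, hδ'⟩ := Metric.eventually_nhds_iff.1 hc
  refine ⟨min (δ / 2) ε', by positivity, fun μ _ p q hp hq h => ?_⟩
  have hd := measurableSet_discrepancy_preimage hp hq
  have hb : ∀ c, Real.negMulLog (μ.real (discrepancy p q ⁻¹' {c})) ≤ ε' := by
    intro c
    cases c with
    | none =>
      refine (Real.negMulLog_le_one_sub_self measureReal_nonneg).trans ?_
      have e : {x | p x ≠ q x} = (discrepancy p q ⁻¹' {none})ᶜ := by
        ext x; simp [discrepancy]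
      rw [e, probReal_compl_eq_one_sub (hd none)] at h
      exact h.trans (min_le_right _ _)
    | some a =>
      refine (hδ' ?_).le
      rw [Real.dist_eq, sub_zero, abs_of_nonneg measureReal_nonneg]
      have : μ.real (discrepancy p q ⁻¹' {some a}) ≤ μ.real {x | p x ≠ q x} :=
        measureReal_mono (fun x hx hxx => by simp [discrepancy, hxx] at hx) (measure_ne_top _ _)
      exact (this.trans (h.trans (min_le_left _ _))).trans_lt (by linarith)
  calc partitionEntropy μ (discrepancy p q) ≤ ∑ c : Option ι, ε' :=
        Finset.sum_le_sum fun c _ => hb c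
    _ = ε := by
        rw [Finset.sum_const, nsmul_eq_mul, Finset.card_univ, Fintype.card_option, hε']
        push_cast; field_simp

end Entropy

/-! ### Growth rates -/

theorem tendsto_coe_affine_div (L C : ℝ) :
    Tendsto (fun n : ℕ => (((n * L + C) / n : ℝ) : EReal)) atTop (𝓝 (L : EReal)) := by
  refine (continuous_coe_real_ereal.tendsto L).comp ?_
  have h : Tendsto (fun n : ℕ => L + C / n) atTop (𝓝 (L + 0)) :=
    tendsto_const_nhds.add (tendsto_const_div_atTop_nhds_zero_nat C)
  rw [add_zero] at h
  refine h.congr' ?_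
  filter_upwards [eventually_gt_atTop 0] with n hn
  have : (n : ℝ) ≠ 0 := by exact_mod_cast hn.ne'
  field_simp

/-- The constant `C` vanishes in the limit; it also absorbs the mismatch between the n + 1 factors
of a join and the divisor n. -/
theorem limsup_div_le {u : ℕ → ℝ} {L C : ℝ} (h : ∀ n, u n ≤ n * L + C) :
    limsup (fun n : ℕ => ((u n / n : ℝ) : EReal)) atTop ≤ L := by
  rw [← (tendsto_coe_affine_div L C).limsup_eq]
  refine limsup_le_limsup (Eventually.of_forall fun n => ?_)
  exact EReal.coe_le_coe_iff.2 (div_le_div_of_nonneg_right (h n) n.cast_nonneg)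

theorem le_limsup_div {u : ℕ → ℝ} {L C : ℝ} (h : ∀ n, n * L + C ≤ u n) :
    (L : EReal) ≤ limsup (fun n : ℕ => ((u n / n : ℝ) : EReal)) atTop := by
  rw [← (tendsto_coe_affine_div L C).limsup_eq]
  refine limsup_le_limsup (Eventually.of_forall fun n => ?_)
  exact EReal.coe_le_coe_iff.2 (div_le_div_of_nonneg_right (h n) n.cast_nonneg)

/-- The entropy of a partition is at most `L` if partitions that are arbitrarily close to it have
itineraries of exponential complexity at most `L`. -/
theorem metricEntropyWrt_le {X : Type*} [MeasurableSpace X] {ι : Type*} [Fintype ι]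
    {μ : Measure X} [IsProbabilityMeasure μ] {T : X → X}
    (hT : MeasurePreserving T μ μ) {p : X → ι} (hp : ∀ a, MeasurableSet (p ⁻¹' {a})) {L : ℝ}
    (h : ∀ δ > 0, ∃ (q : X → ι) (C : ℝ), (∀ a, MeasurableSet (q ⁻¹' {a})) ∧
      μ.real {x | p x ≠ q x} ≤ δ ∧ ∀ n : ℕ, partitionEntropy μ (itinerary T q n) ≤ n * L + C) :
    metricEntropyWrt T μ p ≤ L := by
  classical
  -- It suffices to reach every real M > L; the margin M - L pays for the discrepancy at each time
  -- step.
  refine EReal.le_of_forall_lt_iff_le.1 fun M hM => ?_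
  have hM' : 0 < M - L := sub_pos.2 (EReal.coe_lt_coe_iff.1 hM)
  obtain ⟨δ, hδ, H⟩ := exists_partitionEntropy_discrepancy_le (X := X) (ι := ι) hM'
  obtain ⟨q, C, hq, hpq, hC⟩ := h δ hδ
  refine limsup_div_le (C := C + (M - L)) fun n => ?_
  have h1 := partitionEntropy_itinerary_le_add hT hp hq n
  have h2 := H μ p q hp hq hpq
  have h3 : (n + 1 : ℝ) * partitionEntropy μ (discrepancy p q) ≤ (n + 1) * (M - L) := by gcongr
  have := hC n
  nlinarith

/-! ### The β-transformation and Parry's measure -/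

section BetaMap

variable {β : ℝ}

theorem measurable_betaMap (β : ℝ) : Measurable (betaMap β) :=
  measurable_fract.comp (measurable_const.mul measurable_id)

theorem measurable_betaDigits (β : ℝ) : Measurable (betaDigits β) := by
  refine measurable_pi_lambda _ fun k => Measurable.ite ?_ measurable_const measurable_const
  exact measurableSet_le measurable_const
    (measurable_const.mul ((measurable_betaMap β).iterate k))

theorem betaDigits_betaMap (β x : ℝ) (k : ℕ) :
    betaDigits β (betaMap β x) k = betaDigits β x (k + 1) := rfl

theorem betaDigits_iterate (β x : ℝ) (n k : ℕ) :
    betaDigits β ((betaMap β)^[n] x) k = betaDigits β x (n + k) := by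
  simp only [betaDigits, ← Function.iterate_add_apply, add_comm]

theorem betaDigits_zero_eq_zero {x : ℝ} : betaDigits β x 0 = 0 ↔ β * x < 1 := by
  rw [betaDigits, Function.iterate_zero_apply]
  split_ifs with h <;> simpa using h

theorem betaDigits_zero_eq_one {x : ℝ} : betaDigits β x 0 = 1 ↔ 1 ≤ β * x := by
  rw [betaDigits, Function.iterate_zero_apply]
  split_ifs with h <;> simp [h]

theorem betaMap_mem_Ico (β x : ℝ) : betaMap β x ∈ Ico (0 : ℝ) 1 :=
  ⟨Int.fract_nonneg _, Int.fract_lt_one _⟩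

theorem iterate_betaMap_mem_Icc {x : ℝ} (hx : x ∈ Icc (0 : ℝ) 1) (n : ℕ) :
    (betaMap β)^[n] x ∈ Icc (0 : ℝ) 1 := by
  cases n with
  | zero => exact hx
  | succ n =>
    rw [Function.iterate_succ_apply']
    exact Ico_subset_Icc_self (betaMap_mem_Ico _ _)

theorem iterate_betaMap_mem_Ico {x : ℝ} (hx : x ∈ Ico (0 : ℝ) 1) (n : ℕ) :
    (betaMap β)^[n] x ∈ Ico (0 : ℝ) 1 := by
  cases n with
  | zero => exact hx
  | succ n =>
    rw [Function.iterate_succ_apply']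
    exact betaMap_mem_Ico _ _

theorem betaMap_of_lt {x : ℝ} (h0 : 0 ≤ β * x) (h1 : β * x < 1) : betaMap β x = β * x :=
  Int.fract_eq_self.2 ⟨h0, h1⟩

theorem betaMap_of_le {x : ℝ} (h0 : 1 ≤ β * x) (h1 : β * x < 2) : betaMap β x = β * x - 1 := by
  rw [betaMap, ← Int.fract_sub_one]
  exact Int.fract_eq_self.2 ⟨by linarith, by linarith⟩

theorem betaMap_eq (hβ : β ∈ Ioo (1 : ℝ) 2) {x : ℝ} (hx : x ∈ Icc (0 : ℝ) 1) :
    betaMap β x = β * x - ((betaDigits β x 0 : ℕ) : ℝ) := by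
  obtain ⟨h1, h2⟩ := hβ
  have hx0 : 0 ≤ β * x := mul_nonneg (by linarith) hx.1
  by_cases h : β * x < 1
  · rw [betaMap_of_lt hx0 h, betaDigits_zero_eq_zero.2 h]; simp
  · push Not at h
    have : β * x < 2 := by nlinarith [hx.2]
    rw [betaMap_of_le h this, betaDigits_zero_eq_one.2 h]; simp

/-- After n digits the remainder is β⁻ⁿ Tⁿx, which tends to 0. The endpoint x = 1 is included
because Parry's density follows the orbit of 1. -/
theorem hasSum_betaDigits (hβ : β ∈ Ioo (1 : ℝ) 2) {x : ℝ} (hx : x ∈ Icc (0 : ℝ) 1) :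
    HasSum (fun k => ((betaDigits β x k : ℕ) : ℝ) * β⁻¹ ^ (k + 1)) x := by
  have hβ0 : 0 < β := by linarith [hβ.1]
  have hβ1 : β⁻¹ < 1 := inv_lt_one_of_one_lt₀ hβ.1
  rw [hasSum_iff_tendsto_nat_of_nonneg (fun k => by positivity)]
  have hs : ∀ n : ℕ, ∑ k ∈ Finset.range n, ((betaDigits β x k : ℕ) : ℝ) * β⁻¹ ^ (k + 1) =
      x - β⁻¹ ^ n * (betaMap β)^[n] x := by
    intro n
    induction n with
    | zero => simp
    | succ n ih =>
      have := betaMap_eq hβ (iterate_betaMap_mem_Icc (β := β) hx n)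
      rw [betaDigits_iterate, add_zero] at this
      rw [Finset.sum_range_succ, ih, Function.iterate_succ_apply', this, pow_succ]
      field_simp
      ring
  simp_rw [hs]
  have h0 : Tendsto (fun n : ℕ => β⁻¹ ^ n * (betaMap β)^[n] x) atTop (𝓝 0) := by
    refine squeeze_zero (fun n => mul_nonneg (by positivity) (iterate_betaMap_mem_Icc hx n).1)
      (fun n => mul_le_of_le_one_right (by positivity) (iterate_betaMap_mem_Icc hx n).2)
      (tendsto_pow_atTop_nhds_zero_of_lt_one (by positivity) hβ1)
  simpa using tendsto_const_nhds.sub h0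

/-- The branch of the β-transformation with digit `d` maps its part of `[0, a)` onto `[0, a')`
with `a' = branchEnd β d a`. -/
def branchEnd (β : ℝ) (d : Fin 2) (a : ℝ) : ℝ := if d = 0 then min (β * a) 1 else max (β * a - 1) 0

theorem branchEnd_mem (hβ : β ∈ Ioo (1 : ℝ) 2) (d : Fin 2) {a : ℝ} (ha : a ∈ Icc (0 : ℝ) 1) :
    branchEnd β d a ∈ Icc (0 : ℝ) 1 := by
  obtain ⟨h1, h2⟩ := hβ
  have : 0 ≤ β * a := mul_nonneg (by linarith) ha.1
  have : β * a ≤ 2 := by nlinarith [ha.2]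
  unfold branchEnd
  split_ifs
  · exact ⟨le_min ‹_› zero_le_one, min_le_right _ _⟩
  · exact ⟨le_max_right _ _, max_le (by linarith) zero_le_one⟩

/-- Each branch is affine of slope β and its image starts at 0, so Lebesgue measure scales by β⁻¹
under pull-back. -/
theorem volume_branch (hβ : β ∈ Ioo (1 : ℝ) 2) (d : Fin 2) {a : ℝ} (ha : a ∈ Icc (0 : ℝ) 1)
    (E : Set ℝ) : volume (Ico 0 a ∩ {x | betaDigits β x 0 = d} ∩ betaMap β ⁻¹' E) =
      ENNReal.ofReal β⁻¹ * volume (Ico 0 (branchEnd β d a) ∩ E) := by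
  obtain ⟨h1, h2⟩ := hβ
  have hβ0 : 0 < β := by linarith
  have hscale := fun s => Real.volume_preimage_mul_left hβ0.ne' s
  rw [abs_of_pos (by positivity)] at hscale
  rcases (show d = 0 ∨ d = 1 by fin_cases d <;> simp) with rfl | rfl
  · rw [← hscale]
    congr 1
    ext x
    simp only [mem_inter_iff, mem_Ico, mem_ofPred_eq, mem_preimage, betaDigits_zero_eq_zero,
      branchEnd, if_true, lt_min_iff, mul_lt_mul_iff_right₀ hβ0, mul_nonneg_iff_of_pos_left hβ0]
    constructor
    · rintro ⟨⟨⟨hx0, hxa⟩, hx1⟩, hE⟩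
      rw [betaMap_of_lt (by positivity) hx1] at hE
      exact ⟨⟨hx0, hxa, hx1⟩, hE⟩
    · rintro ⟨⟨hx0, hxa, hx1⟩, hE⟩
      rw [betaMap_of_lt (by positivity) hx1]
      exact ⟨⟨⟨hx0, hxa⟩, hx1⟩, hE⟩
  · have e : Ico 0 a ∩ {x | betaDigits β x 0 = 1} ∩ betaMap β ⁻¹' E =
        (β * ·) ⁻¹' ((· - 1) ⁻¹' (Ico 0 (branchEnd β 1 a) ∩ E)) := by
      ext x
      simp only [mem_inter_iff, mem_Ico, mem_ofPred_eq, mem_preimage, betaDigits_zero_eq_one,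
        branchEnd, one_ne_zero, if_false, lt_max_iff, sub_lt_sub_iff_right,
        mul_lt_mul_iff_right₀ hβ0, sub_nonneg]
      constructor
      · rintro ⟨⟨⟨hx0, hxa⟩, hx1⟩, hE⟩
        have : β * x < 2 := by nlinarith [ha.2]
        rw [betaMap_of_le hx1 this] at hE
        exact ⟨⟨hx1, Or.inl hxa⟩, hE⟩
      · rintro ⟨⟨hx1, hx⟩, hE⟩
        have hxa : x < a := hx.resolve_right fun h => by linarith
        have : β * x < 2 := by nlinarith [ha.2]
        rw [betaMap_of_le hx1 this]
        exact ⟨⟨⟨by by_contra! h; nlinarith, hxa⟩, hx1⟩, hE⟩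
    have hshift := measure_preimage_add_right volume (-1 : ℝ) (Ico 0 (branchEnd β 1 a) ∩ E)
    simp only [← sub_eq_add_neg] at hshift
    rw [e, hscale, hshift]

theorem volume_preimage_betaMap (hβ : β ∈ Ioo (1 : ℝ) 2) {a : ℝ} (ha : a ∈ Icc (0 : ℝ) 1)
    (E : Set ℝ) : volume (Ico 0 a ∩ betaMap β ⁻¹' E) = ENNReal.ofReal β⁻¹ *
      (volume (Ico 0 (branchEnd β 0 a) ∩ E) + volume (Ico 0 (branchEnd β 1 a) ∩ E)) := by
  have hm : MeasurableSet {x | betaDigits β x 0 = 0} :=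
    (measurable_pi_apply 0).comp (measurable_betaDigits β) (measurableSet_singleton 0)
  rw [mul_add, ← volume_branch hβ 0 ha, ← volume_branch hβ 1 ha,
    ← measure_inter_add_sdiff (Ico 0 a ∩ betaMap β ⁻¹' E) hm]
  congr 2
  · rw [inter_right_comm]
  · ext x
    simp only [Set.mem_sdiff, mem_inter_iff, mem_ofPred_eq]
    have : betaDigits β x 0 = 1 ↔ ¬betaDigits β x 0 = 0 := by
      rw [betaDigits_zero_eq_zero, betaDigits_zero_eq_one, not_lt]
    rw [this]; tauto

/-- The points whose first `m` digits agree with `w`. -/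
def digitCylinder (β : ℝ) (m : ℕ) (w : ℕ → Fin 2) : Set ℝ := {x | ∀ i < m, betaDigits β x i = w i}

/-- Both branches send the left end of their domain to 0, so the image of a cylinder under Tᵐ is
again an interval [0, b), and the induction need only track its right end. A null cylinder has b =
0. -/
theorem exists_volume_digitCylinder (hβ : β ∈ Ioo (1 : ℝ) 2) (m : ℕ) (w : ℕ → Fin 2) {a : ℝ}
    (ha : a ∈ Icc (0 : ℝ) 1) : ∃ b ∈ Icc (0 : ℝ) 1, ∀ E : Set ℝ,
      volume (Ico 0 a ∩ digitCylinder β m w ∩ (betaMap β)^[m] ⁻¹' E) =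
        ENNReal.ofReal β⁻¹ ^ m * volume (Ico 0 b ∩ E) := by
  induction m generalizing w a with
  | zero => exact ⟨a, ha, fun E => by simp [digitCylinder]⟩
  | succ m ih =>
    obtain ⟨b, hb, H⟩ := ih (fun i => w (i + 1)) (branchEnd_mem hβ (w 0) ha)
    refine ⟨b, hb, fun E => ?_⟩
    rw [pow_succ', mul_assoc, ← H, inter_assoc (Ico 0 (branchEnd β (w 0) a)),
      ← volume_branch hβ (w 0) ha]
    congr 1
    ext x
    simp only [mem_inter_iff, mem_preimage, digitCylinder, mem_ofPred_eq,
      Function.iterate_succ_apply, betaDigits_betaMap, Nat.forall_lt_succ_left, and_assoc]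

theorem measurableSet_digitCylinder (m : ℕ) (w : ℕ → Fin 2) :
    MeasurableSet (digitCylinder β m w) := by
  have : digitCylinder β m w = betaDigits β ⁻¹' ⋂ i, ⋂ (_ : i < m), {u | u i = w i} := by
    ext; simp [digitCylinder]
  rw [this]
  refine measurable_betaDigits β (MeasurableSet.iInter fun i => MeasurableSet.iInter fun _ => ?_)
  exact measurableSet_eq_fun (measurable_pi_apply i) measurable_const

/-! ### Parry's density: invariance and comparison with Lebesgue measure -/

theorem one_mem_Icc : (1 : ℝ) ∈ Icc (0 : ℝ) 1 := right_mem_Icc.2 zero_le_one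

/-- The measure is a superposition of Lebesgue measure on the intervals [0, Tⁿ1) with weights β⁻ⁿ.
-/
theorem parryUnnormalized_apply {E : Set ℝ} (hE : MeasurableSet E) :
    parryUnnormalized β E =
      ∑' n : ℕ, ENNReal.ofReal (β⁻¹ ^ n) * volume (Ico 0 ((betaMap β)^[n] 1) ∩ E) := by
  rw [parryUnnormalized, withDensity_apply _ hE, Measure.restrict_restrict hE, lintegral_tsum]
  · refine tsum_congr fun n => ?_
    have hm : MeasurableSet (Iio ((betaMap β)^[n] 1)) := measurableSet_Iio
    have : ∀ x : ℝ, (if x < (betaMap β)^[n] 1 then ENNReal.ofReal (β⁻¹ ^ n) else 0) =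
        (Iio ((betaMap β)^[n] 1)).indicator (fun _ => ENNReal.ofReal (β⁻¹ ^ n)) x := fun x => rfl
    simp_rw [this]
    rw [lintegral_indicator_const hm, Measure.restrict_apply hm]
    congr 2
    ext x
    have := (iterate_betaMap_mem_Icc (β := β) one_mem_Icc n).2
    simp only [mem_inter_iff, mem_Iio, mem_Ico]
    constructor
    · rintro ⟨h1, h2, h3, h4⟩; exact ⟨⟨h3, h1⟩, h2⟩
    · rintro ⟨⟨h3, h1⟩, h2⟩; exact ⟨h1, h2, h3, h1.trans_le this⟩
  · exact fun n => (Measurable.ite measurableSet_Iio measurable_const measurable_const).aemeasurable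

/-- The total mass of the weights `β⁻ⁿ`. -/
def parryBound (β : ℝ) : ENNReal := ∑' n : ℕ, ENNReal.ofReal (β⁻¹ ^ n)

theorem parryBound_ne_top (hβ : β ∈ Ioo (1 : ℝ) 2) : parryBound β ≠ ⊤ := by
  have hβ0 : 0 < β := by linarith [hβ.1]
  have hβ1 : β⁻¹ < 1 := inv_lt_one_of_one_lt₀ hβ.1
  rw [parryBound, ← ENNReal.ofReal_tsum_of_nonneg (fun n => by positivity)
    (summable_geometric_of_lt_one (by positivity) hβ1)]
  exact ENNReal.ofReal_ne_top

/-- The term n = 0, with T⁰1 = 1, already makes the density at least 1 on [0,1). -/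
theorem volume_le_parryUnnormalized {E : Set ℝ} (hE : MeasurableSet E) :
    volume (Ico 0 1 ∩ E) ≤ parryUnnormalized β E := by
  rw [parryUnnormalized_apply hE]
  refine le_trans (le_of_eq ?_) (ENNReal.le_tsum 0)
  simp

theorem parryUnnormalized_le_volume {E : Set ℝ} (hE : MeasurableSet E) :
    parryUnnormalized β E ≤ parryBound β * volume (Ico 0 1 ∩ E) := by
  rw [parryUnnormalized_apply hE, parryBound, ← ENNReal.tsum_mul_right]
  refine ENNReal.tsum_le_tsum fun n => ?_
  gcongr
  exact (iterate_betaMap_mem_Icc one_mem_Icc n).2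

/-- Up to the factor β⁻¹, the two branches map [0, Tⁿ1) onto d_n copies of [0,1) and one copy of [0,
Tⁿ⁺¹1), where d_n is the n-th digit of 1. The weights d_n β⁻ⁿ⁻¹ of the full copies sum to 1 and
restore the term n = 0; the other copies give the terms n + 1. -/
theorem parryUnnormalized_preimage (hβ : β ∈ Ioo (1 : ℝ) 2) {E : Set ℝ} (hE : MeasurableSet E) :
    parryUnnormalized β (betaMap β ⁻¹' E) = parryUnnormalized β E := by
  have hβ0 : 0 < β := by linarith [hβ.1]
  rw [parryUnnormalized_apply hE, parryUnnormalized_apply (measurable_betaMap β hE)]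
  have hterm : ∀ n : ℕ, ENNReal.ofReal (β⁻¹ ^ n) *
      volume (Ico 0 ((betaMap β)^[n] 1) ∩ betaMap β ⁻¹' E) =
      ENNReal.ofReal (((betaDigits β 1 n : ℕ) : ℝ) * β⁻¹ ^ (n + 1)) * volume (Ico 0 1 ∩ E) +
      ENNReal.ofReal (β⁻¹ ^ (n + 1)) * volume (Ico 0 ((betaMap β)^[n + 1] 1) ∩ E) := by
    intro n
    have ht := iterate_betaMap_mem_Icc (β := β) one_mem_Icc n
    have hd := betaDigits_iterate β 1 n 0
    rw [add_zero] at hd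
    rw [volume_preimage_betaMap hβ ht, ← mul_assoc, ← ENNReal.ofReal_mul (by positivity),
      ← pow_succ, Function.iterate_succ_apply', mul_add, ← hd]
    set t := (betaMap β)^[n] 1
    have ht0 : 0 ≤ β * t := mul_nonneg hβ0.le ht.1
    by_cases h : β * t < 1
    · have e1 : branchEnd β 0 t = β * t := by simp [branchEnd, h.le]
      have e2 : branchEnd β 1 t = 0 := by simp [branchEnd, h.le]
      rw [e1, e2, betaDigits_zero_eq_zero.2 h, betaMap_of_lt ht0 h]
      simp
    · push Not at h
      have ht2 : β * t < 2 := by nlinarith [ht.2, hβ.2]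
      have e1 : branchEnd β 0 t = 1 := by simp [branchEnd, h]
      have e2 : branchEnd β 1 t = β * t - 1 := by simp [branchEnd, h]
      rw [e1, e2, betaDigits_zero_eq_one.2 h, betaMap_of_le h ht2]
      simp
  simp_rw [hterm]
  rw [ENNReal.tsum_add, ENNReal.tsum_mul_right,
    ← ENNReal.ofReal_tsum_of_nonneg (fun n => by positivity)
      (hasSum_betaDigits hβ one_mem_Icc).summable, (hasSum_betaDigits hβ one_mem_Icc).tsum_eq,
    tsum_eq_zero_add' ENNReal.summable (f := fun n : ℕ => ENNReal.ofReal (β⁻¹ ^ n) *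
      volume (Ico 0 ((betaMap β)^[n] 1) ∩ E))]
  simp

theorem one_le_parryUnnormalized_univ : 1 ≤ parryUnnormalized β univ := by
  simpa using volume_le_parryUnnormalized (β := β) MeasurableSet.univ

theorem parryUnnormalized_univ_ne_top (hβ : β ∈ Ioo (1 : ℝ) 2) : parryUnnormalized β univ ≠ ⊤ := by
  refine ne_top_of_le_ne_top (parryBound_ne_top hβ)
    ((parryUnnormalized_le_volume MeasurableSet.univ).trans (le_of_eq ?_))
  simp

theorem isProbabilityMeasure_parryInterval (hβ : β ∈ Ioo (1 : ℝ) 2) :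
    IsProbabilityMeasure (parryInterval β) := by
  refine ⟨?_⟩
  rw [parryInterval, Measure.smul_apply, smul_eq_mul]
  exact ENNReal.inv_mul_cancel (zero_lt_one.trans_le one_le_parryUnnormalized_univ).ne'
    (parryUnnormalized_univ_ne_top hβ)

theorem measurePreserving_betaMap (hβ : β ∈ Ioo (1 : ℝ) 2) :
    MeasurePreserving (betaMap β) (parryInterval β) (parryInterval β) := by
  refine ⟨measurable_betaMap β, Measure.ext fun E hE => ?_⟩
  rw [Measure.map_apply (measurable_betaMap β) hE, parryInterval, Measure.smul_apply,
    Measure.smul_apply, parryUnnormalized_preimage hβ hE]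

theorem parryInterval_le_volume {E : Set ℝ} (hE : MeasurableSet E) :
    parryInterval β E ≤ parryBound β * volume (Ico 0 1 ∩ E) := by
  rw [parryInterval, Measure.smul_apply, smul_eq_mul]
  refine le_trans (mul_le_of_le_one_left' ?_) (parryUnnormalized_le_volume hE)
  exact ENNReal.inv_le_one.2 one_le_parryUnnormalized_univ

theorem ae_mem_Ico_parryInterval : ∀ᵐ x ∂parryInterval β, x ∈ Ico (0 : ℝ) 1 := by
  have := parryInterval_le_volume (β := β) (measurableSet_Ico (a := (0 : ℝ)) (b := 1)).compl
  rw [inter_compl_self, measure_empty, mul_zero] at this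
  exact (mem_ae_iff (s := Ico (0 : ℝ) 1)).2 (by simpa using this)

theorem parryInterval_singleton (x : ℝ) : parryInterval β {x} = 0 := by
  have h := parryInterval_le_volume (β := β) (measurableSet_singleton x)
  rw [measure_mono_null inter_subset_right (Real.volume_singleton (a := x)), mul_zero] at h
  simpa using h

theorem parryInterval_digitCylinder_le (hβ : β ∈ Ioo (1 : ℝ) 2) (m : ℕ) (w : ℕ → Fin 2) :
    parryInterval β (digitCylinder β m w) ≤ parryBound β * ENNReal.ofReal β⁻¹ ^ m := by
  refine (parryInterval_le_volume (measurableSet_digitCylinder m w)).trans ?_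
  obtain ⟨b, hb, H⟩ := exists_volume_digitCylinder hβ m w one_mem_Icc
  have := H univ
  rw [preimage_univ, inter_univ, inter_univ, Real.volume_Ico, sub_zero] at this
  rw [this]
  gcongr
  exact mul_le_of_le_one_right' (ENNReal.ofReal_le_one.2 hb.2)

/-! ### Quasi-mixing -/

/-- Lebesgue measure is comparable to an invariant measure, so pulling back by Tⁿ costs only a
constant that does not depend on n. -/
theorem volume_le_volume_preimage_iterate (hβ : β ∈ Ioo (1 : ℝ) 2) {D : Set ℝ}
    (hD : MeasurableSet D) (n : ℕ) :
    volume (Ico 0 1 ∩ D) ≤ parryBound β * volume (Ico 0 1 ∩ (betaMap β)^[n] ⁻¹' D) := by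
  have hT : MeasurePreserving (betaMap β) (parryUnnormalized β) (parryUnnormalized β) := by
    refine ⟨measurable_betaMap β, Measure.ext fun E hE => ?_⟩
    rw [Measure.map_apply (measurable_betaMap β) hE, parryUnnormalized_preimage hβ hE]
  calc volume (Ico 0 1 ∩ D) ≤ parryUnnormalized β D := volume_le_parryUnnormalized hD
    _ = parryUnnormalized β ((betaMap β)^[n] ⁻¹' D) :=
        ((hT.iterate n).measure_preimage hD.nullMeasurableSet).symm
    _ ≤ _ := parryUnnormalized_le_volume ((measurable_betaMap β).iterate n hD)

/-- Under the first branch [0, a) grows by the factor β until, within k steps, it covers [0,1); then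
the previous comparison applies. The shrinking β⁻¹ of each step is balanced by the growth of a to
βa. -/
theorem volume_Ico_le_volume_preimage_iterate (hβ : β ∈ Ioo (1 : ℝ) 2) {D : Set ℝ}
    (hD : MeasurableSet D) (k : ℕ) {a : ℝ} (ha : a ∈ Icc (0 : ℝ) 1) (hk : 1 ≤ β ^ k * a) {n : ℕ}
    (hn : k ≤ n) :
    ENNReal.ofReal a * volume (Ico 0 1 ∩ D) ≤
      ENNReal.ofReal β * parryBound β * volume (Ico 0 a ∩ (betaMap β)^[n] ⁻¹' D) := by
  have hβ0 : 0 < β := by linarith [hβ.1]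
  have hcancel : ENNReal.ofReal β * ENNReal.ofReal β⁻¹ = 1 := by
    rw [← ENNReal.ofReal_mul hβ0.le, mul_inv_cancel₀ hβ0.ne', ENNReal.ofReal_one]
  have hβ1 : 1 ≤ ENNReal.ofReal β := ENNReal.one_le_ofReal.2 hβ.1.le
  induction k generalizing a n with
  | zero =>
    obtain rfl : a = 1 := le_antisymm ha.2 (by simpa using hk)
    rw [ENNReal.ofReal_one, one_mul, mul_assoc]
    exact (volume_le_volume_preimage_iterate hβ hD n).trans (le_mul_of_one_le_left' hβ1)
  | succ k ih =>
    obtain ⟨n, rfl⟩ : ∃ n', n = n' + 1 := ⟨n - 1, by omega⟩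
    have hpre : (betaMap β)^[n + 1] ⁻¹' D = betaMap β ⁻¹' ((betaMap β)^[n] ⁻¹' D) := by
      rw [Function.iterate_succ, preimage_comp]
    rw [hpre, volume_preimage_betaMap hβ ha]
    by_cases h : 1 ≤ β * a
    -- The first branch alone now covers [0,1). The factor β⁻¹ of this last step is not compensated
    -- by growth, whence the extra β in the constant.
    · have e1 : branchEnd β 0 a = 1 := by simp [branchEnd, h]
      rw [e1]
      calc ENNReal.ofReal a * volume (Ico 0 1 ∩ D) ≤ volume (Ico 0 1 ∩ D) :=
            mul_le_of_le_one_left' (ENNReal.ofReal_le_one.2 ha.2)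
        _ ≤ parryBound β * volume (Ico 0 1 ∩ (betaMap β)^[n] ⁻¹' D) :=
            volume_le_volume_preimage_iterate hβ hD n
        _ = ENNReal.ofReal β * ENNReal.ofReal β⁻¹ *
            (parryBound β * volume (Ico 0 1 ∩ (betaMap β)^[n] ⁻¹' D)) := by rw [hcancel, one_mul]
        _ = ENNReal.ofReal β * parryBound β *
            (ENNReal.ofReal β⁻¹ * volume (Ico 0 1 ∩ (betaMap β)^[n] ⁻¹' D)) := by ring
        _ ≤ _ := by gcongr; exact le_self_add
    · push Not at h
      have e1 : branchEnd β 0 a = β * a := by simp [branchEnd, h.le]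
      rw [e1]
      have h2 := ih (a := β * a) (n := n) ⟨mul_nonneg hβ0.le ha.1, h.le⟩
        (by rw [← mul_assoc, ← pow_succ]; exact hk) (by omega)
      calc ENNReal.ofReal a * volume (Ico 0 1 ∩ D)
          = ENNReal.ofReal β⁻¹ * (ENNReal.ofReal (β * a) * volume (Ico 0 1 ∩ D)) := by
            rw [← mul_assoc, ← ENNReal.ofReal_mul (by positivity), inv_mul_cancel_left₀ hβ0.ne']
        _ ≤ ENNReal.ofReal β⁻¹ * (ENNReal.ofReal β * parryBound β *
            volume (Ico 0 (β * a) ∩ (betaMap β)^[n] ⁻¹' D)) := by gcongr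
        _ = ENNReal.ofReal β * parryBound β *
            (ENNReal.ofReal β⁻¹ * volume (Ico 0 (β * a) ∩ (betaMap β)^[n] ⁻¹' D)) := by ring
        _ ≤ _ := by gcongr; exact le_self_add

/-- Tᵐ sends the cylinder affinely onto [0, b), which needs about log(1/b)/log β more steps to fill
[0,1). The threshold for n depends on the cylinder, but the constant does not. -/
theorem eventually_volume_digitCylinder_mul_le (hβ : β ∈ Ioo (1 : ℝ) 2) (m : ℕ) (w : ℕ → Fin 2) :
    ∀ᶠ n in atTop, ∀ D : Set ℝ, MeasurableSet D →
      volume (Ico 0 1 ∩ digitCylinder β m w) * volume (Ico 0 1 ∩ D) ≤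
        ENNReal.ofReal β * parryBound β *
          volume (Ico 0 1 ∩ digitCylinder β m w ∩ (betaMap β)^[n] ⁻¹' D) := by
  obtain ⟨b, hb, H⟩ := exists_volume_digitCylinder hβ m w one_mem_Icc
  have hvol := H univ
  rw [preimage_univ, inter_univ, inter_univ, Real.volume_Ico, sub_zero] at hvol
  rcases hb.1.eq_or_lt with h0 | h0
  · refine Eventually.of_forall fun n D _ => ?_
    rw [hvol, ← h0]; simp
  · obtain ⟨k, hk⟩ := pow_unbounded_of_one_lt b⁻¹ hβ.1
    have hk' : 1 ≤ β ^ k * b := by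
      have := mul_le_mul_of_nonneg_right hk.le h0.le
      rwa [inv_mul_cancel₀ h0.ne'] at this
    filter_upwards [eventually_ge_atTop (m + k)] with n hn D hD
    obtain ⟨n, rfl⟩ := Nat.exists_eq_add_of_le (show m ≤ n by omega)
    have hpre : (betaMap β)^[m + n] ⁻¹' D = (betaMap β)^[m] ⁻¹' ((betaMap β)^[n] ⁻¹' D) := by
      rw [add_comm, Function.iterate_add, preimage_comp]
    rw [hpre, H, hvol, mul_assoc, mul_left_comm _ (ENNReal.ofReal β⁻¹ ^ m)]
    exact mul_le_mul_right (volume_Ico_le_volume_preimage_iterate hβ hD k hb hk' (by omega)) _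

/-- The β-transformation is mixing up to a multiplicative constant. -/
theorem exists_parryInterval_mul_le (hβ : β ∈ Ioo (1 : ℝ) 2) :
    ∃ Q : ENNReal, Q ≠ ⊤ ∧ ∀ (m : ℕ) (W : Set (Fin m → Fin 2)),
    ∀ᶠ n in atTop, ∀ D : Set ℝ, MeasurableSet D →
      parryInterval β {x | (fun i : Fin m => betaDigits β x i) ∈ W} * parryInterval β D ≤
        Q * parryInterval β
          ({x | (fun i : Fin m => betaDigits β x i) ∈ W} ∩ (betaMap β)^[n] ⁻¹' D) := by
  classical
  set K := parryBound β
  have hK : K ≠ ⊤ := parryBound_ne_top hβ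
  set c := parryUnnormalized β univ
  -- K * K replaces the two Parry masses by Lebesgue masses, β K is the Lebesgue mixing constant,
  -- and c undoes the normalization.
  refine ⟨K * K * (ENNReal.ofReal β * K * c), ?_, fun m W => ?_⟩
  · exact ENNReal.mul_ne_top (ENNReal.mul_ne_top hK hK) (ENNReal.mul_ne_top
      (ENNReal.mul_ne_top ENNReal.ofReal_ne_top hK) (parryUnnormalized_univ_ne_top hβ))
  let ext : (Fin m → Fin 2) → ℕ → Fin 2 := fun w i => if h : i < m then w ⟨i, h⟩ else 0
  have hcyl : ∀ w x, x ∈ digitCylinder β m (ext w) ↔ (fun i : Fin m => betaDigits β x i) = w := by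
    intro w x
    simp only [digitCylinder, mem_ofPred_eq, funext_iff, ext]
    exact ⟨fun h i => by simpa using h i i.2, fun h i hi => by simpa [hi] using h ⟨i, hi⟩⟩
  -- There are finitely many words of length m, so one threshold for n serves them all.
  have hev : ∀ᶠ n in atTop, ∀ w : Fin m → Fin 2, ∀ D : Set ℝ, MeasurableSet D →
      volume (Ico 0 1 ∩ digitCylinder β m (ext w)) * volume (Ico 0 1 ∩ D) ≤
        ENNReal.ofReal β * K *
          volume (Ico 0 1 ∩ digitCylinder β m (ext w) ∩ (betaMap β)^[n] ⁻¹' D) :=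
    eventually_all.2 fun w => eventually_volume_digitCylinder_mul_le hβ m (ext w)
  filter_upwards [hev] with n hn D hD
  set C : Set ℝ := {x | (fun i : Fin m => betaDigits β x i) ∈ W}
  have hCm : MeasurableSet C := by
    have : Measurable fun x => (fun i : Fin m => betaDigits β x i) :=
      measurable_pi_lambda _ fun i => (measurable_pi_apply (i : ℕ)).comp (measurable_betaDigits β)
    exact this W.toFinite.measurableSet
  have hsum : ∀ E, MeasurableSet E → volume (Ico 0 1 ∩ C ∩ E) =
      ∑ w ∈ W.toFinset, volume (Ico 0 1 ∩ digitCylinder β m (ext w) ∩ E) := by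
    intro E hE
    rw [← measure_biUnion_finset]
    · congr 1
      ext x
      simp only [mem_inter_iff, mem_iUnion, hcyl, mem_toFinset]
      constructor
      · rintro ⟨⟨h1, h2⟩, h3⟩; exact ⟨_, h2, ⟨h1, rfl⟩, h3⟩
      · rintro ⟨w, h2, ⟨h1, rfl⟩, h3⟩; exact ⟨⟨h1, h2⟩, h3⟩
    · intro w _ w' _ hne
      refine Set.disjoint_left.2 fun x hx hx' => hne ?_
      rw [← (hcyl w x).1 hx.1.2, ← (hcyl w' x).1 hx'.1.2]
    · exact fun w _ => (measurableSet_Ico.inter (measurableSet_digitCylinder m _)).inter hE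
  have hvol : volume (Ico 0 1 ∩ C) * volume (Ico 0 1 ∩ D) ≤
      ENNReal.ofReal β * K * volume (Ico 0 1 ∩ C ∩ (betaMap β)^[n] ⁻¹' D) := by
    have h1 := hsum univ MeasurableSet.univ
    simp only [inter_univ] at h1
    rw [h1, hsum _ ((measurable_betaMap β).iterate n hD), Finset.sum_mul, Finset.mul_sum]
    exact Finset.sum_le_sum fun w _ => hn w D hD
  have hCD : MeasurableSet (C ∩ (betaMap β)^[n] ⁻¹' D) :=
    hCm.inter ((measurable_betaMap β).iterate n hD)
  have hback : volume (Ico 0 1 ∩ C ∩ (betaMap β)^[n] ⁻¹' D) ≤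
      c * parryInterval β (C ∩ (betaMap β)^[n] ⁻¹' D) := by
    rw [inter_assoc]
    refine (volume_le_parryUnnormalized (β := β) hCD).trans (le_of_eq ?_)
    rw [parryInterval, Measure.smul_apply, smul_eq_mul, ← mul_assoc, ENNReal.mul_inv_cancel
      (zero_lt_one.trans_le one_le_parryUnnormalized_univ).ne'
      (parryUnnormalized_univ_ne_top hβ), one_mul]
  calc parryInterval β C * parryInterval β D
      ≤ (K * volume (Ico 0 1 ∩ C)) * (K * volume (Ico 0 1 ∩ D)) :=
        mul_le_mul' (parryInterval_le_volume hCm) (parryInterval_le_volume hD)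
    _ = K * K * (volume (Ico 0 1 ∩ C) * volume (Ico 0 1 ∩ D)) := by ring
    _ ≤ K * K * (ENNReal.ofReal β * K * (c * parryInterval β (C ∩ (betaMap β)^[n] ⁻¹' D))) := by
        exact mul_le_mul_right (hvol.trans (mul_le_mul_right hback _)) _
    _ = _ := by ring

/-! ### Counting admissible words -/

/-- The words of length `n` that are read off along orbit segments `x_{i+1} = β x_i - w_i` in
`[0,1]` with `x_0 ≤ a`. -/
def orbitWords (β : ℝ) (n : ℕ) (a : ℝ) : Set (Fin n → Fin 2) :=
  {w | ∃ x : ℕ → ℝ, x 0 ≤ a ∧ (∀ i ≤ n, x i ∈ Icc (0 : ℝ) 1) ∧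
    ∀ i : Fin n, x (i + 1) = β * x i - ((w i : ℕ) : ℝ)}

theorem cons_mem_orbitWords {n : ℕ} {a : ℝ} (hβ0 : 0 < β) {w : Fin (n + 1) → Fin 2}
    (hw : w ∈ orbitWords β (n + 1) a) :
    Fin.tail w ∈ orbitWords β n (min (β * a) 1) ∧ w 0 = 0 ∨
      Fin.tail w ∈ orbitWords β n (β * a - 1) ∧ w 0 = 1 ∧ 1 ≤ β * a := by
  obtain ⟨x, hxa, hx, hrec⟩ := hw
  have h0 := hrec 0
  have hx1 := hx 1 (by omega)
  have ha : β * x 0 ≤ β * a := by gcongr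
  simp only [Fin.val_zero, zero_add] at h0
  have htail : ∀ b, x 1 ≤ b → Fin.tail w ∈ orbitWords β n b := fun b hb =>
    ⟨fun i => x (i + 1), hb, fun i hi => hx _ (by omega), fun i => by
      simpa [Fin.tail] using hrec i.succ⟩
  rcases (show w 0 = 0 ∨ w 0 = 1 by generalize w 0 = d; fin_cases d <;> simp) with h | h
  · rw [h] at h0
    simp at h0
    exact Or.inl ⟨htail _ (le_min (by linarith) hx1.2), h⟩
  · rw [h] at h0
    simp at h0
    exact Or.inr ⟨htail _ (by linarith), h, by linarith [hx1.1]⟩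

theorem orbitWords_succ_subset {n : ℕ} {a : ℝ} (hβ0 : 0 < β) :
    orbitWords β (n + 1) a ⊆
      Fin.cons (α := fun _ => Fin 2) 0 '' orbitWords β n (min (β * a) 1) ∪
      Fin.cons (α := fun _ => Fin 2) 1 '' {w | w ∈ orbitWords β n (β * a - 1) ∧ 1 ≤ β * a} := by
  intro w hw
  rcases cons_mem_orbitWords hβ0 hw with ⟨h1, h2⟩ | ⟨h1, h2, h3⟩
  · exact Or.inl ⟨_, h1, by rw [← h2, Fin.cons_self_tail]⟩
  · exact Or.inr ⟨_, ⟨h1, h3⟩, by rw [← h2, Fin.cons_self_tail]⟩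

/-- Split by the first digit. If both digits occur, the new right ends 1 and βa - 1 add up to βa, so
the linear term only gains the factor β, and the surplus 1 is at most βa, the contribution of the
new geometric term. Words may take either digit at x = β⁻¹, so the count covers greedy expansions as
well as the branches of the baker map. -/
theorem ncard_orbitWords_le_sum (hβ : β ∈ Ioo (1 : ℝ) 2) (n : ℕ) {a : ℝ} (ha : a ∈ Icc (0 : ℝ) 1) :
    ((orbitWords β n a).ncard : ℝ) ≤ (∑ j ∈ Finset.range n, β⁻¹ ^ j) * a * β ^ n + 1 := by
  have hβ0 : 0 < β := by linarith [hβ.1]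
  induction n generalizing a with
  | zero =>
    have : (orbitWords β 0 a).ncard ≤ 1 := ncard_le_one_of_subsingleton _
    simpa using this
  | succ n ih =>
    set A := ∑ j ∈ Finset.range n, β⁻¹ ^ j with hA
    have hA0 : 0 ≤ A := Finset.sum_nonneg fun j _ => by positivity
    have hsub := ncard_le_ncard (orbitWords_succ_subset (β := β) (n := n) (a := a) hβ0)
      (Set.toFinite _)
    have h1 := hsub.trans (ncard_union_le _ _)
    have h2 := ncard_image_le (f := Fin.cons (α := fun _ : Fin (n + 1) => Fin 2) 0)
      (Set.toFinite (orbitWords β n (min (β * a) 1)))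
    have h3 := ncard_image_le (f := Fin.cons (α := fun _ : Fin (n + 1) => Fin 2) 1)
      (Set.toFinite {w | w ∈ orbitWords β n (β * a - 1) ∧ 1 ≤ β * a})
    have h4 : ((orbitWords β (n + 1) a).ncard : ℝ) ≤ (orbitWords β n (min (β * a) 1)).ncard +
        {w | w ∈ orbitWords β n (β * a - 1) ∧ 1 ≤ β * a}.ncard := by
      exact_mod_cast h1.trans (add_le_add h2 h3)
    have hβa : 0 ≤ β * a := mul_nonneg hβ0.le ha.1
    have hβa2 : β * a < 2 := by nlinarith [ha.2, hβ.2]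
    have hpow : β⁻¹ ^ n * β ^ n = 1 := by rw [← mul_pow, inv_mul_cancel₀ hβ0.ne', one_pow]
    have hRHS : (∑ j ∈ Finset.range (n + 1), β⁻¹ ^ j) * a * β ^ (n + 1) + 1 =
        A * (β * a) * β ^ n + β * a + 1 := by
      rw [Finset.sum_range_succ, ← hA, pow_succ]
      linear_combination (a * β) * hpow
    rw [hRHS]
    by_cases h : 1 ≤ β * a
    · rw [min_eq_right h] at h4
      simp only [h, and_true] at h4
      have i1 := ih one_mem_Icc
      have i2 := ih (a := β * a - 1) ⟨by linarith, by linarith⟩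
      change _ ≤ _ + ((orbitWords β n (β * a - 1)).ncard : ℝ) at h4
      nlinarith
    · push Not at h
      rw [min_eq_left h.le] at h4
      have : {w | w ∈ orbitWords β n (β * a - 1) ∧ 1 ≤ β * a} = ∅ := by
        ext w; simp [h.not_ge]
      rw [this, ncard_empty] at h4
      have i1 := ih (a := β * a) ⟨hβa, h.le⟩
      push_cast at h4
      linarith

theorem exists_ncard_orbitWords_le (hβ : β ∈ Ioo (1 : ℝ) 2) :
    ∃ C : ℝ, 0 < C ∧ ∀ n, ((orbitWords β n 1).ncard : ℝ) ≤ C * β ^ n := by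
  have hβ0 : 0 < β := by linarith [hβ.1]
  have hβ1 : β⁻¹ < 1 := inv_lt_one_of_one_lt₀ hβ.1
  have hs := summable_geometric_of_lt_one (inv_nonneg.2 hβ0.le) hβ1
  have hC : 0 ≤ ∑' j : ℕ, β⁻¹ ^ j := tsum_nonneg fun j => by positivity
  refine ⟨(∑' j : ℕ, β⁻¹ ^ j) + 1, by positivity, fun n => ?_⟩
  refine (ncard_orbitWords_le_sum hβ n one_mem_Icc).trans ?_
  have h1 : ∑ j ∈ Finset.range n, β⁻¹ ^ j ≤ ∑' j : ℕ, β⁻¹ ^ j :=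
    hs.sum_le_tsum _ fun j _ => by positivity
  have h2 : 1 ≤ β ^ n := one_le_pow₀ hβ.1.le
  rw [mul_one, add_mul, one_mul]
  gcongr

end BetaMap

/-! ### Existence of the Parry measure of the two-sided β-shift -/

section ParryMeasure

variable {β : ℝ}

/-- The one-sided sequence `s_{j-1}, s_{j-2}, …`. -/
def past (j : ℤ) (s : ℤ → Fin 2) : ℕ → Fin 2 := fun k => s (j - (k + 1))

/-- The two-sided sequence `s` with `s_{j-1-k} = u_k` for `k ≥ 0` and zeros elsewhere. -/
def place (j : ℤ) (u : ℕ → Fin 2) : ℤ → Fin 2 := fun k => if k < j then u (j - 1 - k).toNat else 0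

theorem continuous_past (j : ℤ) : Continuous (past j) :=
  continuous_pi fun _ => continuous_apply _

theorem measurable_place (j : ℤ) : Measurable (place j) := by
  refine measurable_pi_lambda _ fun k => ?_
  unfold place
  split_ifs
  · exact measurable_pi_apply _
  · exact measurable_const

theorem past_place {j n : ℤ} (h : j ≤ n) (u : ℕ → Fin 2) (k : ℕ) :
    past j (place n u) k = u ((n - j).toNat + k) := by
  rw [past, place, if_pos (by omega)]
  congr 1
  omega

theorem place_past_apply {j k : ℤ} (h : k < j) (s : ℤ → Fin 2) : place j (past j s) k = s k := by
  rw [place, if_pos h, past]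
  congr 1
  omega

theorem past_place_betaDigits {j n : ℤ} (h : j ≤ n) (x : ℝ) :
    past j (place n (betaDigits β x)) = betaDigits β ((betaMap β)^[(n - j).toNat] x) := by
  funext k
  rw [past_place h, betaDigits_iterate]

/-- Read from i ≤ n, the series has the value Tⁿ⁻ⁱx < 1; read from i > n, it begins with i - n zeros
and has the value β⁻⁽ⁱ⁻ⁿ⁾x. -/
theorem place_betaDigits_mem (hβ : β ∈ Ioo (1 : ℝ) 2) (n : ℤ) {x : ℝ} (hx : x ∈ Ico (0 : ℝ) 1) :
    place n (betaDigits β x) ∈ preBetaShift β := by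
  have hβ0 : 0 < β := by linarith [hβ.1]
  have hβ1 : β⁻¹ < 1 := inv_lt_one_of_one_lt₀ hβ.1
  intro i
  rcases le_total i n with h | h
  · have e : ∀ k : ℕ, place n (betaDigits β x) (i - ((k : ℤ) + 1)) =
        betaDigits β ((betaMap β)^[(n - i).toNat] x) k := fun k =>
      congrFun (past_place_betaDigits h x) k
    have hm := iterate_betaMap_mem_Ico (β := β) hx (n - i).toNat
    simp_rw [e]
    rw [(hasSum_betaDigits hβ (Ico_subset_Icc_self hm)).tsum_eq]
    exact hm.2
  · have hsum := hasSum_betaDigits hβ (Ico_subset_Icc_self hx)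
    obtain ⟨r, rfl⟩ : ∃ r : ℕ, i = n + r := ⟨(i - n).toNat, by omega⟩
    have e1 : ∀ k ∈ Finset.range r,
        ((place n (betaDigits β x) (n + r - ((k : ℤ) + 1)) : ℕ) : ℝ) * β⁻¹ ^ (k + 1) = 0 := by
      intro k hk
      rw [Finset.mem_range] at hk
      rw [place, if_neg (by omega)]
      simp
    have e2 : ∀ k : ℕ,
        ((place n (betaDigits β x) (n + r - (((k + r : ℕ) : ℤ) + 1)) : ℕ) : ℝ) *
          β⁻¹ ^ (k + r + 1) = β⁻¹ ^ r * (((betaDigits β x k : ℕ) : ℝ) * β⁻¹ ^ (k + 1)) := by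
      intro k
      have : place n (betaDigits β x) (n + r - (((k + r : ℕ) : ℤ) + 1)) = betaDigits β x k := by
        rw [place, if_pos (by omega)]
        congr 1
        omega
      rw [this]; ring
    have hs : HasSum (fun k : ℕ => ((place n (betaDigits β x) (n + r - ((k : ℤ) + 1)) : ℕ) : ℝ) *
        β⁻¹ ^ (k + 1)) (β⁻¹ ^ r * x) := by
      rw [← hasSum_nat_add_iff' r, Finset.sum_eq_zero e1, sub_zero]
      simp_rw [e2]
      exact hsum.mul_left _
    rw [hs.tsum_eq]
    calc β⁻¹ ^ r * x ≤ 1 * x := by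
          gcongr
          · exact hx.1
          · exact pow_le_one₀ (by positivity) hβ1.le
      _ < 1 := by linarith [hx.2]

theorem exists_window {t : Set (ℤ → Fin 2)} (ht : t ∈ measurableCylinders fun _ : ℤ => Fin 2) :
    ∃ N₀ : ℕ, ∀ s s' : ℤ → Fin 2, (∀ k : ℤ, -N₀ ≤ k → k < N₀ → s k = s' k) → (s ∈ t ↔ s' ∈ t) := by
  obtain ⟨I, S, -, rfl⟩ := (mem_measurableCylinders t).1 ht
  refine ⟨I.sup Int.natAbs + 1, fun s s' h => ?_⟩
  rw [mem_cylinder, mem_cylinder]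
  have : I.restrict s = I.restrict s' := by
    funext i
    have := Finset.le_sup (f := Int.natAbs) i.2
    exact h i (by omega) (by omega)
  rw [this]

/-- A measure on two-sided sequences is determined by its one-sided marginals. -/
theorem ext_of_map_past {L L' : Measure (ℤ → Fin 2)} [IsProbabilityMeasure L]
    [IsProbabilityMeasure L'] (h : ∀ j, L.map (past j) = L'.map (past j)) : L = L' := by
  refine ext_of_generate_finite _ generateFrom_measurableCylinders.symm
    isPiSystem_measurableCylinders (fun t ht => ?_) (by simp)
  obtain ⟨N, hN⟩ := exists_window ht
  have e : t = past N ⁻¹' (place N ⁻¹' t) := by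
    ext s
    exact hN _ _ fun k _ hk => (place_past_apply hk s).symm
  have hm : MeasurableSet (place N ⁻¹' t) :=
    measurable_place _ (MeasurableSet.of_mem_measurableCylinders ht)
  rw [e, ← Measure.map_apply (continuous_past N).measurable hm, h,
    Measure.map_apply (continuous_past N).measurable hm]

theorem past_shift (j : ℤ) (s : ℤ → Fin 2) : past j (shift s) = past (j - 1) s := by
  funext k
  simp only [past, shift]
  congr 1
  ring

/-- The past at j consists of the digits of Tⁿ⁻ʲx, whose law does not depend on n because Parry's
measure is invariant. -/
theorem map_past_place (hβ : β ∈ Ioo (1 : ℝ) 2) {j n : ℤ} (h : j ≤ n) :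
    ((parryInterval β).map (fun x => place n (betaDigits β x))).map (past j) =
      (parryInterval β).map (betaDigits β) := by
  have hm : Measurable fun x => place n (betaDigits β x) :=
    (measurable_place n).comp (measurable_betaDigits β)
  rw [Measure.map_map (continuous_past j).measurable hm]
  have e : past j ∘ (fun x => place n (betaDigits β x)) =
      betaDigits β ∘ (betaMap β)^[(n - j).toNat] := funext fun x => past_place_betaDigits h x
  rw [e, ← Measure.map_map (measurable_betaDigits β) ((measurable_betaMap β).iterate _),
    ((measurePreserving_betaMap hβ).iterate _).map_eq]

/-- The natural extension by compactness: expansions are placed ever further to the right and a weak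
limit is taken. The marginals of the approximants are eventually constant, so the limit inherits
them, and the closed set `betaShift β` keeps its full mass in the limit. -/
theorem exists_measure_map_past (hβ : β ∈ Ioo (1 : ℝ) 2) :
    ∃ L : Measure (ℤ → Fin 2), IsProbabilityMeasure L ∧
      (∀ j, L.map (past j) = (parryInterval β).map (betaDigits β)) ∧ L (betaShift β)ᶜ = 0 := by
  have hP := isProbabilityMeasure_parryInterval hβ
  have hpm : ∀ n : ℤ, Measurable fun x => place n (betaDigits β x) := fun n =>
    (measurable_place n).comp (measurable_betaDigits β)
  let M : ℕ → ProbabilityMeasure (ℤ → Fin 2) := fun n =>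
    ⟨(parryInterval β).map (fun x => place n (betaDigits β x)),
      Measure.isProbabilityMeasure_map (hpm n).aemeasurable⟩
  -- On a compact space of probability measures a nonprincipal ultrafilter yields a limit without
  -- choosing a subsequence.
  let U : Ultrafilter ℕ := hyperfilter ℕ
  obtain ⟨L, -, hL⟩ := isCompact_univ.ultrafilter_le_nhds (U.map M) (by simp)
  have hL : Tendsto M U (𝓝 L) := hL
  refine ⟨L, inferInstance, fun j => ?_, ?_⟩
  · have h1 := ((ProbabilityMeasure.continuous_map (continuous_past j)).tendsto L).comp hL
    have hmd : IsProbabilityMeasure ((parryInterval β).map (betaDigits β)) :=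
      Measure.isProbabilityMeasure_map (measurable_betaDigits β).aemeasurable
    let D : ProbabilityMeasure (ℕ → Fin 2) := ⟨(parryInterval β).map (betaDigits β), hmd⟩
    have h2 : Tendsto (fun n => ProbabilityMeasure.map (M n)
        (continuous_past j).measurable.aemeasurable) U (𝓝 D) := by
      refine tendsto_const_nhds.congr' ?_
      have : ∀ᶠ n : ℕ in U, j.toNat ≤ n :=
        Nat.hyperfilter_le_atTop (eventually_ge_atTop j.toNat)
      filter_upwards [this] with n hn
      refine Subtype.ext ?_
      exact (map_past_place hβ (by omega)).symm
    have h3 := tendsto_nhds_unique h1 h2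
    exact congrArg Subtype.val h3
  · have hcl : IsClosed (betaShift β) := isClosed_closure
    have h1 := ProbabilityMeasure.limsup_measure_closed_le_of_tendsto hL hcl
    have h2 : ∀ n, (M n : Measure (ℤ → Fin 2)) (betaShift β) = 1 := by
      intro n
      have : ∀ᵐ x ∂parryInterval β, place n (betaDigits β x) ∈ betaShift β := by
        filter_upwards [ae_mem_Ico_parryInterval] with x hx
        exact subset_closure (place_betaDigits_mem hβ n hx)
      change (parryInterval β).map _ _ = 1
      rw [Measure.map_apply (hpm n) hcl.measurableSet]
      exact (prob_compl_eq_zero_iff (hpm n hcl.measurableSet)).1 this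
    simp_rw [h2] at h1
    rw [limsup_const] at h1
    exact (prob_compl_eq_zero_iff hcl.measurableSet).2 (le_antisymm prob_le_one h1)

theorem measurableSet_betaShift (β : ℝ) : MeasurableSet (betaShift β) :=
  isClosed_closure.measurableSet

theorem measurable_betaShiftMap (β : ℝ) : Measurable (betaShiftMap β) :=
  (continuous_shift.measurable.comp measurable_subtype_coe).subtype_mk

theorem exists_isParryMeasure (hβ : β ∈ Ioo (1 : ℝ) 2) :
    ∃ μ : Measure (betaShift β), IsParryMeasure β μ ∧ IsProbabilityMeasure μ := by
  obtain ⟨L, hL, hpast, hsupp⟩ := exists_measure_map_past hβ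
  have hms := measurableSet_betaShift β
  have hemb : MeasurableEmbedding (Subtype.val : betaShift β → ℤ → Fin 2) :=
    MeasurableEmbedding.subtype_coe hms
  set μ : Measure (betaShift β) := L.comap Subtype.val
  have hmap : μ.map Subtype.val = L := by
    rw [hemb.map_comap, Subtype.range_coe]
    exact Measure.restrict_eq_self_of_ae_mem (mem_ae_iff.2 hsupp)
  have hval : ∀ B, MeasurableSet B → μ (Subtype.val ⁻¹' B) = L B := fun B hB => by
    rw [← Measure.map_apply measurable_subtype_coe hB, hmap]
  have hshift : L.map shift = L := by
    have hm := continuous_shift.measurable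
    have := Measure.isProbabilityMeasure_map (μ := L) hm.aemeasurable
    -- The shift only replaces the past at j by the past at j - 1, and all pasts have the same law.
    refine ext_of_map_past fun j => ?_
    rw [Measure.map_map (continuous_past j).measurable hm,
      show past j ∘ shift = past (j - 1) from funext (past_shift j), hpast, hpast]
  refine ⟨μ, ⟨⟨?_, ?_⟩, ?_⟩, ⟨?_⟩⟩
  · exact measurable_betaShiftMap β
  · refine Measure.ext ?_
    rintro _ ⟨B, hB, rfl⟩
    rw [Measure.map_apply (measurable_betaShiftMap β) (measurable_subtype_coe hB), hval B hB]
    have : betaShiftMap β ⁻¹' (Subtype.val ⁻¹' B) = Subtype.val ⁻¹' (shift ⁻¹' B) := rfl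
    rw [this, hval _ (continuous_shift.measurable hB),
      ← Measure.map_apply continuous_shift.measurable hB, hshift]
  · have e : (fun (s : betaShift β) (k : ℕ) => s.1 (-((k : ℤ) + 1))) = past 0 ∘ Subtype.val := by
      funext s k
      simp [past]
    rw [e, ← Measure.map_map (continuous_past 0).measurable measurable_subtype_coe, hmap, hpast]
  · rw [← preimage_univ (f := Subtype.val), hval _ MeasurableSet.univ, measure_univ]

end ParryMeasure

/-! ### Ergodicity and entropy of the Parry measure -/

section ParryErgodic

open scoped symmDiff

variable {β : ℝ} {μ : Measure (betaShift β)}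

/-- The first `m` symbols of a one-sided sequence. -/
def prefixWord (m : ℕ) (u : ℕ → Fin 2) : Fin m → Fin 2 := fun i => u i

theorem measurable_prefixWord (m : ℕ) : Measurable (prefixWord m) :=
  measurable_pi_lambda _ fun i => measurable_pi_apply (i : ℕ)

/-- Every N ≥ N₀ is allowed so that finitely many cylinders can share one window. -/
theorem exists_prefixWord_iff {t : Set (ℤ → Fin 2)}
    (ht : t ∈ measurableCylinders fun _ : ℤ => Fin 2) :
    ∃ N₀ : ℕ, ∀ N ≥ N₀, ∃ W : Set (Fin (2 * N) → Fin 2),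
      ∀ s, s ∈ t ↔ prefixWord (2 * N) (past N s) ∈ W := by
  obtain ⟨N₀, h⟩ := exists_window ht
  refine ⟨N₀, fun N hN => ?_⟩
  let ext : (Fin (2 * N) → Fin 2) → ℕ → Fin 2 := fun w i => if h : i < 2 * N then w ⟨i, h⟩ else 0
  refine ⟨{w | place N (ext w) ∈ t}, fun s => h _ _ fun k hk hk' => ?_⟩
  have hlt : ((N : ℤ) - 1 - k).toNat < 2 * N := by omega
  rw [place, if_pos (by omega)]
  simp only [ext, hlt, dif_pos, prefixWord, past]
  congr 1
  omega

theorem betaShiftMap_iterate_apply (n : ℕ) (s : betaShift β) (k : ℤ) :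
    ((betaShiftMap β)^[n] s).1 k = s.1 (k - n) := by
  induction n generalizing s with
  | zero => simp
  | succ n ih =>
    rw [Function.iterate_succ_apply, ih]
    exact congrArg s.1 (by push_cast; ring)

theorem past_betaShiftMap_iterate (j : ℤ) (n : ℕ) (s : betaShift β) :
    past j ((betaShiftMap β)^[n] s).1 = past (j - n) s.1 := by
  funext k
  rw [past, past, betaShiftMap_iterate_apply]
  exact congrArg s.1 (by ring)

/-- Shifting deletes the first symbols of the past, which thus plays the role of the forward
β-expansion. -/
theorem past_betaShiftMap_iterate_apply (j : ℤ) (n : ℕ) (s : betaShift β) (k : ℕ) :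
    past j ((betaShiftMap β)^[n] s).1 k = past j s.1 (n + k) := by
  rw [past, past, betaShiftMap_iterate_apply]
  exact congrArg s.1 (by push_cast; ring)

theorem measurable_past_val (j : ℤ) : Measurable fun s : betaShift β => past j s.1 :=
  (continuous_past j).measurable.comp measurable_subtype_coe

theorem exists_cylinder_approx [IsFiniteMeasure μ] {A : Set (betaShift β)} (hA : MeasurableSet A)
    {ε : ℝ} (hε : 0 < ε) : ∃ t ∈ measurableCylinders fun _ : ℤ => Fin 2,
      μ.real (A ∆ (Subtype.val ⁻¹' t)) < ε := by
  obtain ⟨B, hB, rfl⟩ := hA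
  have hd := Measure.MeasureDense.of_generateFrom_isSetAlgebra_finite
    (μ := μ.map Subtype.val) (isSetAlgebra_measurableCylinders (α := fun _ : ℤ => Fin 2))
    generateFrom_measurableCylinders.symm
  obtain ⟨t, ht, hlt⟩ := hd.approx B hB (measure_ne_top _ _) ε hε
  refine ⟨t, ht, ?_⟩
  have htm := MeasurableSet.of_mem_measurableCylinders ht
  rw [Measure.map_apply measurable_subtype_coe (hB.symmDiff htm)] at hlt
  exact (ENNReal.toReal_lt_of_lt_ofReal hlt)

namespace IsParryMeasure

theorem measurePreserving_past (h : IsParryMeasure β μ) :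
    MeasurePreserving (fun s : betaShift β => past 0 s.1) μ
      ((parryInterval β).map (betaDigits β)) := by
  refine ⟨measurable_past_val 0, ?_⟩
  rw [← h.marginal]
  have e : (fun (s : betaShift β) (k : ℕ) => s.1 (-((k : ℤ) + 1))) = fun s => past 0 s.1 := by
    funext s k
    simp [past]
  rw [e]

theorem measure_past_preimage (h : IsParryMeasure β μ) {E : Set (ℕ → Fin 2)}
    (hE : MeasurableSet E) :
    μ {s | past 0 s.1 ∈ E} = parryInterval β {x | betaDigits β x ∈ E} := by
  have := h.measurePreserving_past.measure_preimage hE.nullMeasurableSet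
  rw [Measure.map_apply (measurable_betaDigits β) hE] at this
  exact this

theorem ae_past (h : IsParryMeasure β μ) {E : Set (ℕ → Fin 2)} (hE : MeasurableSet E)
    (hx : ∀ᵐ x ∂parryInterval β, betaDigits β x ∈ E) : ∀ᵐ s ∂μ, past 0 s.1 ∈ E := by
  have := h.measure_past_preimage hE.compl
  rw [ae_iff] at hx ⊢
  exact this.trans hx

theorem exists_past_approx [IsProbabilityMeasure μ] (h : IsParryMeasure β μ)
    {A : Set (betaShift β)} (hA : MeasurableSet A) (hinv : betaShiftMap β ⁻¹' A = A) {ε : ℝ}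
    (hε : 0 < ε) : ∃ (m : ℕ) (W : Set (Fin m → Fin 2)),
      μ.real (A ∆ {s | prefixWord m (past 0 s.1) ∈ W}) < ε := by
  obtain ⟨t, ht, hlt⟩ := exists_cylinder_approx (μ := μ) hA hε
  obtain ⟨N, hN⟩ := exists_prefixWord_iff ht
  obtain ⟨W, hW⟩ := hN N le_rfl
  refine ⟨2 * N, W, ?_⟩
  have htm : MeasurableSet (Subtype.val ⁻¹' t : Set (betaShift β)) :=
    measurable_subtype_coe (MeasurableSet.of_mem_measurableCylinders ht)
  rw [← (h.invariant.iterate N).measureReal_preimage (hA.symmDiff htm).nullMeasurableSet] at hlt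
  have hinv' : ∀ n, (betaShiftMap β)^[n] ⁻¹' A = A := by
    intro n
    induction n with
    | zero => rfl
    | succ n ih => rw [Function.iterate_succ, preimage_comp, ih, hinv]
  have e : (betaShiftMap β)^[N] ⁻¹' (Subtype.val ⁻¹' t) =
      {s | prefixWord (2 * N) (past 0 s.1) ∈ W} := by
    ext s
    change ((betaShiftMap β)^[N] s).1 ∈ t ↔ _
    rw [hW, past_betaShiftMap_iterate, sub_self]
    rfl
  rwa [preimage_symmDiff, hinv', e] at hlt

theorem exists_quasiMixing (hβ : β ∈ Ioo (1 : ℝ) 2) [IsProbabilityMeasure μ]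
    (h : IsParryMeasure β μ) : ∃ Q : ℝ, 0 ≤ Q ∧ ∀ (m m' : ℕ) (W : Set (Fin m → Fin 2))
      (W' : Set (Fin m' → Fin 2)), ∃ n : ℕ,
      μ.real {s | prefixWord m (past 0 s.1) ∈ W} * μ.real {s | prefixWord m' (past 0 s.1) ∈ W'} ≤
        Q * μ.real ({s | prefixWord m (past 0 s.1) ∈ W} ∩
          (betaShiftMap β)^[n] ⁻¹' {s | prefixWord m' (past 0 s.1) ∈ W'}) := by
  obtain ⟨Q, hQ, H⟩ := exists_parryInterval_mul_le hβ
  refine ⟨Q.toReal, ENNReal.toReal_nonneg, fun m m' W W' => ?_⟩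
  obtain ⟨n, hn⟩ := (H m W).exists
  refine ⟨n, ?_⟩
  have hW : MeasurableSet (prefixWord m ⁻¹' W) := measurable_prefixWord m W.toFinite.measurableSet
  have hW' : MeasurableSet (prefixWord m' ⁻¹' W') :=
    measurable_prefixWord m' W'.toFinite.measurableSet
  have hS : Measurable fun (u : ℕ → Fin 2) (k : ℕ) => u (n + k) :=
    measurable_pi_lambda _ fun k => measurable_pi_apply _
  have key := hn {x | betaDigits β x ∈ prefixWord m' ⁻¹' W'} (measurable_betaDigits β hW')
  have e1 := h.measure_past_preimage hW
  have e2 := h.measure_past_preimage hW'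
  have e3 := h.measure_past_preimage (hW.inter (hS hW'))
  have e4 : ({s | prefixWord m (past 0 s.1) ∈ W} ∩
      (betaShiftMap β)^[n] ⁻¹' {s | prefixWord m' (past 0 s.1) ∈ W'} : Set (betaShift β)) =
      {s | past 0 s.1 ∈ prefixWord m ⁻¹' W ∩
        (fun (u : ℕ → Fin 2) (k : ℕ) => u (n + k)) ⁻¹' (prefixWord m' ⁻¹' W')} := by
    ext s
    have : past 0 ((betaShiftMap β)^[n] s).1 = fun k => past 0 s.1 (n + k) :=
      funext fun k => past_betaShiftMap_iterate_apply 0 n s k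
    simp only [mem_inter_iff, mem_ofPred_eq, mem_preimage, this]
  have e5 : {x | (fun i : Fin m => betaDigits β x i) ∈ W} ∩
      (betaMap β)^[n] ⁻¹' {x | betaDigits β x ∈ prefixWord m' ⁻¹' W'} =
      {x | betaDigits β x ∈ prefixWord m ⁻¹' W ∩
        (fun (u : ℕ → Fin 2) (k : ℕ) => u (n + k)) ⁻¹' (prefixWord m' ⁻¹' W')} := by
    ext x
    have : betaDigits β ((betaMap β)^[n] x) = fun k => betaDigits β x (n + k) :=
      funext fun k => betaDigits_iterate β x n k
    simp only [mem_inter_iff, mem_ofPred_eq, mem_preimage, this]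
    rfl
  rw [e5, ← e3, ← e4, ← e2] at key
  have key' : μ {s | prefixWord m (past 0 s.1) ∈ W} * μ {s | prefixWord m' (past 0 s.1) ∈ W'} ≤
      Q * μ ({s | prefixWord m (past 0 s.1) ∈ W} ∩
          (betaShiftMap β)^[n] ⁻¹' {s | prefixWord m' (past 0 s.1) ∈ W'}) := by
    refine le_trans (le_of_eq ?_) key
    congr 1
  have := ENNReal.toReal_mono (ENNReal.mul_ne_top hQ (measure_ne_top _ _)) key'
  rwa [ENNReal.toReal_mul, ENNReal.toReal_mul] at this

/-- Approximate A and its complement by past events C and D. Since A never meets a pull-back of its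
complement, C ∩ σ⁻ⁿD has small measure, and quasi-mixing makes μ(C) μ(D) small; hence μ(A) μ(Aᶜ) =
0. -/
theorem ergodic (hβ : β ∈ Ioo (1 : ℝ) 2) [IsProbabilityMeasure μ] (h : IsParryMeasure β μ) :
    Ergodic (betaShiftMap β) μ := by
  refine ⟨h.invariant, ⟨fun A hA hinv => ?_⟩⟩
  obtain ⟨Q, hQ, H⟩ := h.exists_quasiMixing hβ
  have hinv' : betaShiftMap β ⁻¹' Aᶜ = Aᶜ := by rw [preimage_compl, hinv]
  have hinvn : ∀ n, (betaShiftMap β)^[n] ⁻¹' Aᶜ = Aᶜ := by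
    intro n
    induction n with
    | zero => rfl
    | succ n ih => rw [Function.iterate_succ, preimage_comp, ih, hinv']
  have hle : ∀ B C : Set (betaShift β), μ.real B ≤ μ.real C + μ.real (B ∆ C) := by
    intro B C
    refine (measureReal_mono (fun x hx => ?_) (measure_ne_top _ _)).trans (measureReal_union_le _ _)
    by_cases hC : x ∈ C
    · exact Or.inl hC
    · exact Or.inr (Or.inl ⟨hx, hC⟩)
  have hprod : μ.real A * μ.real Aᶜ ≤ 0 := by
    refine le_of_forall_pos_le_add fun δ hδ => ?_
    -- 2Q comes from the bound 2ε on the intersection; 3 comes from expanding (μ(C) + ε)(μ(D) + ε)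
    -- with ε ≤ 1.
    set ε := min 1 (δ / (2 * Q + 3)) with hε
    have hε0 : 0 < ε := by positivity
    have hε1 : ε ≤ 1 := min_le_left _ _
    have hεδ : ε * (2 * Q + 3) ≤ δ := by
      have := min_le_right 1 (δ / (2 * Q + 3))
      rwa [le_div_iff₀ (by positivity)] at this
    obtain ⟨m, W, hW⟩ := h.exists_past_approx hA hinv hε0
    obtain ⟨m', W', hW'⟩ := h.exists_past_approx hA.compl hinv' hε0
    obtain ⟨n, hn⟩ := H m m' W W'
    set C : Set (betaShift β) := {s | prefixWord m (past 0 s.1) ∈ W}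
    set D : Set (betaShift β) := {s | prefixWord m' (past 0 s.1) ∈ W'}
    have hDm : MeasurableSet D := by
      have : MeasurableSet (prefixWord m' ⁻¹' W') :=
        measurable_prefixWord m' W'.toFinite.measurableSet
      exact measurable_past_val 0 this
    have hCD : μ.real (C ∩ (betaShiftMap β)^[n] ⁻¹' D) ≤ 2 * ε := by
      have hsub : C ∩ (betaShiftMap β)^[n] ⁻¹' D ⊆
          (A ∆ C) ∪ (betaShiftMap β)^[n] ⁻¹' (Aᶜ ∆ D) := by
        rintro x ⟨hxC, hxD⟩
        by_cases hx : x ∈ A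
        · right
          have : x ∉ (betaShiftMap β)^[n] ⁻¹' Aᶜ := by rw [hinvn]; simpa using hx
          exact Or.inr ⟨hxD, this⟩
        · exact Or.inl (Or.inr ⟨hxC, hx⟩)
      have h1 := (measureReal_mono hsub (measure_ne_top μ _)).trans (measureReal_union_le _ _)
      rw [(h.invariant.iterate n).measureReal_preimage
        (hA.compl.symmDiff hDm).nullMeasurableSet] at h1
      linarith
    have h1 := hle A C
    have h2 := hle Aᶜ D
    have hC0 : 0 ≤ μ.real C := measureReal_nonneg
    have hD0 : 0 ≤ μ.real D := measureReal_nonneg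
    have hC1 : μ.real C ≤ 1 := measureReal_le_one
    have hD1 : μ.real D ≤ 1 := measureReal_le_one
    calc μ.real A * μ.real Aᶜ ≤ (μ.real C + ε) * (μ.real D + ε) := by
          apply mul_le_mul <;> first | linarith | exact measureReal_nonneg
      _ = μ.real C * μ.real D + ε * (μ.real C + μ.real D + ε) := by ring
      _ ≤ Q * (2 * ε) + ε * (1 + 1 + 1) := by
          refine add_le_add (hn.trans (by gcongr)) ?_
          gcongr
      _ = ε * (2 * Q + 3) := by ring
      _ ≤ 0 + δ := by linarith
  have h0 : μ.real A * μ.real Aᶜ = 0 :=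
    le_antisymm hprod (mul_nonneg measureReal_nonneg measureReal_nonneg)
  rw [eventuallyConst_set']
  rcases mul_eq_zero.1 h0 with h0 | h0
  · left
    rw [measureReal_eq_zero_iff] at h0
    exact ae_eq_empty.2 h0
  · right
    rw [measureReal_eq_zero_iff] at h0
    exact ae_eq_univ.2 h0

/-- The entropy of words of length `m` is at most `m log β`, up to a constant. -/
theorem exists_partitionEntropy_prefixWord_le (hβ : β ∈ Ioo (1 : ℝ) 2) [IsProbabilityMeasure μ]
    (h : IsParryMeasure β μ) : ∃ C : ℝ, ∀ m N : ℕ,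
      partitionEntropy μ (fun s => prefixWord m (past N s.1)) ≤ m * Real.log β + C := by
  classical
  have hβ0 : 0 < β := by linarith [hβ.1]
  obtain ⟨C, hC, H⟩ := exists_ncard_orbitWords_le hβ
  refine ⟨Real.log C, fun m N => ?_⟩
  have hmeas : ∀ (N : ℤ) (c : Fin m → Fin 2),
      MeasurableSet ((fun s : betaShift β => prefixWord m (past N s.1)) ⁻¹' {c}) := fun N c =>
    ((measurable_prefixWord m).comp (measurable_past_val N)) (measurableSet_singleton c)
  rw [← partitionEntropy_comp_measurePreserving (h.invariant.iterate N) (hmeas N)]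
  have e : (fun s : betaShift β => prefixWord m (past N s.1)) ∘ (betaShiftMap β)^[N] =
      fun s => prefixWord m (past 0 s.1) := by
    funext s
    simp only [Function.comp, past_betaShiftMap_iterate, sub_self]
  rw [e]
  have hfin := (orbitWords β m 1).toFinite
  have hsupp : ∀ᵐ s ∂μ, prefixWord m (past 0 s.1) ∈ hfin.toFinset := by
    have hE : MeasurableSet (prefixWord m ⁻¹' orbitWords β m 1) :=
      measurable_prefixWord m hfin.measurableSet
    have := h.ae_past hE (by
      filter_upwards [ae_mem_Ico_parryInterval] with x hx
      have hx' := Ico_subset_Icc_self hx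
      refine ⟨fun i => (betaMap β)^[i] x, hx.2.le, fun i _ => iterate_betaMap_mem_Icc hx' i,
        fun i => ?_⟩
      beta_reduce
      rw [Function.iterate_succ_apply', betaMap_eq hβ (iterate_betaMap_mem_Icc hx' i),
        betaDigits_iterate, add_zero]
      rfl)
    filter_upwards [this] with s hs
    simpa using hs
  refine (partitionEntropy_le_log_card (hmeas 0) _ hsupp).trans ?_
  rw [← ncard_eq_toFinset_card _ hfin]
  have hpos : (0 : ℝ) < (orbitWords β m 1).ncard := by
    obtain ⟨s, hs⟩ := hsupp.exists
    have : (orbitWords β m 1).Nonempty := ⟨_, by simpa using hs⟩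
    exact_mod_cast (ncard_pos hfin).2 this
  refine (Real.log_le_log hpos (H m)).trans (le_of_eq ?_)
  rw [Real.log_mul hC.ne' (by positivity), Real.log_pow]
  ring

/-- Every partition is approximated by one read off a window of 2N symbols; the itinerary of the
latter up to time n is a function of a word of length 2N + n, whose entropy is at most (2N + n) log
β + C. -/
theorem metricEntropyWrt_le_log (hβ : β ∈ Ioo (1 : ℝ) 2) [IsProbabilityMeasure μ]
    (h : IsParryMeasure β μ) {k : ℕ} {p : betaShift β → Fin k} (hp : Measurable p) :
    metricEntropyWrt (betaShiftMap β) μ p ≤ Real.log β := by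
  classical
  have hp' : ∀ a, MeasurableSet (p ⁻¹' {a}) := fun a => hp (measurableSet_singleton a)
  obtain ⟨C, hC⟩ := h.exists_partitionEntropy_prefixWord_le hβ
  refine metricEntropyWrt_le h.invariant hp' fun δ hδ => ?_
  have hne : Nonempty (betaShift β) := by
    by_contra hemp
    rw [not_nonempty_iff] at hemp
    have := measure_univ (μ := μ)
    rw [univ_eq_empty_iff.2 hemp, measure_empty] at this
    exact zero_ne_one this
  have hk : Nonempty (Fin k) := hne.map p
  have hk0 : (0 : ℝ) < k := by
    have := Fin.pos_iff_nonempty.2 hk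
    exact_mod_cast this
  choose t ht hlt using fun a : Fin k =>
    exists_cylinder_approx (μ := μ) (hp' a) (show 0 < δ / k by positivity)
  choose N₀ hN₀ using fun a : Fin k => exists_prefixWord_iff (ht a)
  set N := Finset.univ.sup N₀
  choose W hW using fun a : Fin k => hN₀ a N (Finset.le_sup (Finset.mem_univ a))
  let g : (Fin (2 * N) → Fin 2) → Fin k := fun w =>
    if hw : ∃ a, w ∈ W a then hw.choose else Classical.arbitrary _
  let q : betaShift β → Fin k := fun s => g (prefixWord (2 * N) (past N s.1))
  have hq : ∀ a, MeasurableSet (q ⁻¹' {a}) := by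
    intro a
    have : MeasurableSet (prefixWord (2 * N) ⁻¹' (g ⁻¹' {a})) :=
      measurable_prefixWord _ (Set.toFinite _).measurableSet
    exact measurable_past_val (N : ℤ) this
  refine ⟨q, 2 * N * Real.log β + C, hq, ?_, fun n => ?_⟩
  -- If some cylinder contains s, then s lies in the one chosen by `q` but not in the matching cell
  -- of `p`. If none does, s lies in its own cell but not in the cylinder approximating it.
  · have hsub : {s | p s ≠ q s} ⊆ ⋃ a, (p ⁻¹' {a}) ∆ (Subtype.val ⁻¹' t a) := by
      intro s hs
      rw [mem_iUnion]
      by_cases hst : ∃ a, prefixWord (2 * N) (past N s.1) ∈ W a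
      · have hqs : q s = hst.choose := dif_pos hst
        refine ⟨q s, Or.inr ⟨?_, hs⟩⟩
        have := hst.choose_spec
        rw [← hW, ← hqs] at this
        exact this
      · refine ⟨p s, Or.inl ⟨rfl, fun hmem => hst ⟨p s, (hW _ _).1 hmem⟩⟩⟩
    refine (measureReal_mono hsub (measure_ne_top _ _)).trans ?_
    refine (measureReal_iUnion_fintype_le _).trans ?_
    calc ∑ a, μ.real ((p ⁻¹' {a}) ∆ (Subtype.val ⁻¹' t a)) ≤ ∑ _a : Fin k, δ / k :=
          Finset.sum_le_sum fun a _ => (hlt a).le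
      _ = δ := by
          rw [Finset.sum_const, Finset.card_univ, Fintype.card_fin, nsmul_eq_mul]
          field_simp
  · have e : itinerary (betaShiftMap β) q n =
        (fun (w : Fin (2 * N + n) → Fin 2) (i : Fin (n + 1)) =>
          g fun j : Fin (2 * N) => w ⟨i + j, by omega⟩) ∘
        fun s => prefixWord (2 * N + n) (past N s.1) := by
      funext s i
      simp only [itinerary, q, Function.comp]
      congr 1
      funext j
      exact past_betaShiftMap_iterate_apply _ _ _ _
    rw [e]
    refine (partitionEntropy_comp_le (fun c => ?_) _).trans ((hC _ _).trans (le_of_eq ?_))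
    · exact ((measurable_prefixWord _).comp (measurable_past_val (N : ℤ)))
        (measurableSet_singleton c)
    · push_cast; ring

/-- The time-zero partition of the β-shift has entropy at least `log β`. -/
theorem log_le_metricEntropyWrt (hβ : β ∈ Ioo (1 : ℝ) 2) [IsProbabilityMeasure μ]
    (h : IsParryMeasure β μ) :
    (Real.log β : EReal) ≤ metricEntropyWrt (betaShiftMap β) μ (fun s => s.1 (-1)) := by
  have hβ0 : 0 < β := by linarith [hβ.1]
  have hK : parryBound β ≠ ⊤ := parryBound_ne_top hβ
  have hK0 : 0 < (parryBound β).toReal := by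
    refine ENNReal.toReal_pos (fun h0 => ?_) hK
    have := ENNReal.tsum_eq_zero.1 h0 0
    simp at this
  -- Cylinders of length n + 1 have mass at most K β⁻ⁿ⁻¹, so the entropy is at least (n + 1) log β -
  -- log K.
  refine le_limsup_div (C := Real.log β - Real.log (parryBound β).toReal) fun n => ?_
  have e : itinerary (betaShiftMap β) (fun s : betaShift β => s.1 (-1)) n =
      fun s => prefixWord (n + 1) (past 0 s.1) := by
    funext s i
    simp only [itinerary, prefixWord, past, betaShiftMap_iterate_apply]
    exact congrArg s.1 (by ring)
  rw [e]
  have hmeas : ∀ c : Fin (n + 1) → Fin 2,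
      MeasurableSet ((fun s : betaShift β => prefixWord (n + 1) (past 0 s.1)) ⁻¹' {c}) := fun c =>
    ((measurable_prefixWord _).comp (measurable_past_val 0)) (measurableSet_singleton c)
  have hb : ∀ c : Fin (n + 1) → Fin 2,
      μ.real ((fun s : betaShift β => prefixWord (n + 1) (past 0 s.1)) ⁻¹' {c}) ≤
        (parryBound β).toReal * β⁻¹ ^ (n + 1) := by
    intro c
    have h1 := h.measure_past_preimage (measurable_prefixWord (n + 1) (measurableSet_singleton c))
    have h2 := parryInterval_digitCylinder_le hβ (n + 1)
      (fun i => if hi : i < n + 1 then c ⟨i, hi⟩ else 0)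
    have h3 : digitCylinder β (n + 1) (fun i => if hi : i < n + 1 then c ⟨i, hi⟩ else 0) =
        {x | betaDigits β x ∈ prefixWord (n + 1) ⁻¹' {c}} := by
      ext x
      simp only [digitCylinder, mem_ofPred_eq, mem_preimage, mem_singleton_iff, funext_iff,
        prefixWord]
      exact ⟨fun H i => by rw [H i i.2, dif_pos i.2], fun H i hi => by rw [dif_pos hi, ← H ⟨i, hi⟩]⟩
    rw [h3, ← h1] at h2
    have h4 := ENNReal.toReal_mono
      (ENNReal.mul_ne_top hK (ENNReal.pow_ne_top ENNReal.ofReal_ne_top)) h2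
    rw [ENNReal.toReal_mul, ENNReal.toReal_pow, ENNReal.toReal_ofReal (by positivity)] at h4
    exact h4
  refine le_trans (le_of_eq ?_) (neg_log_le_partitionEntropy hmeas hb)
  rw [Real.log_mul hK0.ne' (by positivity), Real.log_pow, Real.log_inv]
  push_cast
  ring

theorem metricEntropy_eq (hβ : β ∈ Ioo (1 : ℝ) 2) [IsProbabilityMeasure μ]
    (h : IsParryMeasure β μ) : metricEntropy (betaShiftMap β) μ = Real.log β := by
  refine le_antisymm (iSup_le fun k => iSup_le fun p => iSup_le fun hp =>
    h.metricEntropyWrt_le_log hβ hp) ?_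
  have hm : Measurable fun s : betaShift β => s.1 (-1) :=
    (measurable_pi_apply _).comp measurable_subtype_coe
  exact (h.log_le_metricEntropyWrt hβ).trans (le_iSup_of_le 2 (le_iSup_of_le _
    (le_iSup_of_le hm le_rfl)))

end IsParryMeasure

end ParryErgodic

/-! ### The attractor -/

section Attractor

variable {β τ : ℝ}

/-- The unit square. -/
def unitSquare : Set (ℝ × ℝ) := Icc (0 : ℝ) 1 ×ˢ Icc (0 : ℝ) 1

/-- The intersection of the forward images of the unit square. -/
def attractorCore (β τ : ℝ) : Set (ℝ × ℝ) := ⋂ i : ℕ, (bakerMap β τ)^[i] '' unitSquare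

/-- The branch of the map that is used at `p`. -/
def bakerDigit (β : ℝ) (p : ℝ × ℝ) : Fin 2 := if p.1 ≤ β⁻¹ then 0 else 1

theorem bakerMap_eq (p : ℝ × ℝ) : bakerMap β τ p =
    (β * p.1 - ((bakerDigit β p : ℕ) : ℝ), τ * p.2 + ((bakerDigit β p : ℕ) : ℝ) * (1 - τ)) := by
  unfold bakerMap bakerDigit
  split_ifs <;> simp

theorem bakerMap_mem_unitSquare (hβ : β ∈ Ioo (1 : ℝ) 2) (hτ : τ ∈ Ioo (0 : ℝ) (1 / 2))
    {p : ℝ × ℝ} (hp : p ∈ unitSquare) : bakerMap β τ p ∈ unitSquare := by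
  obtain ⟨⟨hx0, hx1⟩, hy0, hy1⟩ := hp
  obtain ⟨hβ1, hβ2⟩ := hβ
  obtain ⟨hτ0, hτ1⟩ := hτ
  have hβ0 : 0 < β := by linarith
  unfold bakerMap
  split_ifs with h
  · have : β * p.1 ≤ 1 := by
      have := mul_le_mul_of_nonneg_left h hβ0.le
      rwa [mul_inv_cancel₀ hβ0.ne'] at this
    refine ⟨⟨by positivity, this⟩, ?_, ?_⟩ <;> dsimp only <;> nlinarith
  · push Not at h
    have : 1 < β * p.1 := by
      have := mul_lt_mul_of_pos_left h hβ0
      rwa [mul_inv_cancel₀ hβ0.ne'] at this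
    refine ⟨⟨?_, ?_⟩, ?_, ?_⟩ <;> dsimp only <;> nlinarith

theorem attractorCore_subset : attractorCore β τ ⊆ unitSquare := by
  intro p hp
  simpa using mem_iInter.1 hp 0

theorem isClosed_unitSquare : IsClosed unitSquare := isClosed_Icc.prod isClosed_Icc

theorem attractor_subset : attractor β τ ⊆ unitSquare :=
  closure_minimal attractorCore_subset isClosed_unitSquare

theorem isCompact_attractor : IsCompact (attractor β τ) :=
  (isCompact_Icc.prod isCompact_Icc).of_isClosed_subset isClosed_closure attractor_subset

theorem bakerMap_mem_attractorCore (hβ : β ∈ Ioo (1 : ℝ) 2) (hτ : τ ∈ Ioo (0 : ℝ) (1 / 2))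
    {p : ℝ × ℝ} (hp : p ∈ attractorCore β τ) : bakerMap β τ p ∈ attractorCore β τ := by
  refine mem_iInter.2 fun i => ?_
  cases i with
  | zero => simpa using bakerMap_mem_unitSquare hβ hτ (attractorCore_subset hp)
  | succ i =>
    obtain ⟨q, hq, rfl⟩ := mem_iInter.1 hp i
    exact ⟨q, hq, Function.iterate_succ_apply' _ _ _⟩

/-- Horizontal fibres of the images of the square are downward closed. -/
theorem mem_image_iterate_of_le (hβ : β ∈ Ioo (1 : ℝ) 2) (i : ℕ) {x x' y : ℝ}
    (h : (x, y) ∈ (bakerMap β τ)^[i] '' unitSquare) (hx0 : 0 < x') (hx : x' ≤ x) :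
    (x', y) ∈ (bakerMap β τ)^[i] '' unitSquare := by
  have hβ0 : 0 < β := by linarith [hβ.1]
  induction i generalizing x x' y with
  | zero =>
    simp only [Function.iterate_zero, image_id] at h ⊢
    exact ⟨⟨hx0.le, hx.trans h.1.2⟩, h.2⟩
  | succ i ih =>
    obtain ⟨q, hq, he⟩ := h
    rw [Function.iterate_succ_apply'] at he
    have hmem : (((bakerMap β τ)^[i] q).1, ((bakerMap β τ)^[i] q).2) ∈
        (bakerMap β τ)^[i] '' unitSquare := ⟨q, hq, rfl⟩
    set u := ((bakerMap β τ)^[i] q).1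
    set v := ((bakerMap β τ)^[i] q).2
    have key : ∃ u', 0 < u' ∧ u' ≤ u ∧ bakerMap β τ (u', v) = (x', y) := by
      rw [bakerMap] at he
      split_ifs at he with hu
      · rw [Prod.mk.injEq] at he
        obtain ⟨h1, h2⟩ := he
        change β * u = x at h1
        have hle : x' / β ≤ u := by rw [div_le_iff₀ hβ0]; linarith
        refine ⟨x' / β, by positivity, hle, ?_⟩
        rw [bakerMap, if_pos (hle.trans hu), ← h2]
        simp only [mul_div_cancel₀ _ hβ0.ne']
        rfl
      · rw [Prod.mk.injEq] at he
        obtain ⟨h1, h2⟩ := he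
        change β * u - 1 = x at h1
        refine ⟨(x' + 1) / β, by positivity, by rw [div_le_iff₀ hβ0]; linarith, ?_⟩
        -- This is where 0 < x' matters: x' = 0 would require the preimage abscissa β⁻¹, which
        -- belongs to the left branch.
        have hn : ¬(x' + 1) / β ≤ β⁻¹ := by
          rw [not_le, lt_div_iff₀ hβ0, inv_mul_cancel₀ hβ0.ne']; linarith
        rw [bakerMap, if_neg hn, ← h2]
        simp only [mul_div_cancel₀ _ hβ0.ne', add_sub_cancel_right]
        rfl
    obtain ⟨u', hu0, hu, he'⟩ := key
    obtain ⟨r, hr, hre⟩ := ih hmem hu0 hu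
    exact ⟨r, hr, by rw [Function.iterate_succ_apply', hre, he']⟩

/-- The map is discontinuous on the line x = β⁻¹, so invariance of the core does not pass to its
closure automatically. On the left the map agrees with the continuous map that first truncates x at
β⁻¹, and truncation preserves the core because its fibres are downward closed. On the open right
part the map is continuous. -/
theorem mapsTo_attractor (hβ : β ∈ Ioo (1 : ℝ) 2) (hτ : τ ∈ Ioo (0 : ℝ) (1 / 2)) :
    MapsTo (bakerMap β τ) (attractor β τ) (attractor β τ) := by
  have hβ0 : 0 < β := by linarith [hβ.1]
  intro p hp
  by_cases h : p.1 ≤ β⁻¹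
  · let g : ℝ × ℝ → ℝ × ℝ := fun q => (β * min q.1 β⁻¹, τ * q.2)
    have hg : Continuous g := by fun_prop
    have hmaps : MapsTo g (attractorCore β τ) (attractorCore β τ) := by
      intro q hq
      have hq' : (min q.1 β⁻¹, q.2) ∈ attractorCore β τ := by
        rcases le_total q.1 β⁻¹ with hle | hle
        · rwa [min_eq_left hle]
        · rw [min_eq_right hle]
          exact mem_iInter.2 fun i =>
            mem_image_iterate_of_le hβ i (mem_iInter.1 hq i) (by positivity) hle
      have := bakerMap_mem_attractorCore hβ hτ hq'
      rwa [bakerMap, if_pos (min_le_right _ _)] at this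
    have := hmaps.closure hg hp
    simp only [g, min_eq_left h] at this
    rw [bakerMap, if_pos h]
    exact this
  · have hcont : ContinuousAt (bakerMap β τ) p := by
      have hev : (fun q : ℝ × ℝ => (β * q.1 - 1, τ * q.2 + (1 - τ))) =ᶠ[𝓝 p] bakerMap β τ := by
        have : {q : ℝ × ℝ | β⁻¹ < q.1} ∈ 𝓝 p :=
          (isOpen_lt continuous_const continuous_fst).mem_nhds (not_le.1 h)
        filter_upwards [this] with q hq
        rw [bakerMap, if_neg (not_le.2 hq)]
      exact ContinuousAt.congr (by fun_prop) hev
    refine closure_mono ?_ (mem_closure_image hcont hp)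
    rintro _ ⟨q, hq, rfl⟩
    exact bakerMap_mem_attractorCore hβ hτ hq

/-- The bottom edge is the image of its own part over [0, β⁻¹], hence lies in every forward image of
the square. The lower entropy bound is found on this edge. -/
theorem segment_mem_attractor (hβ : β ∈ Ioo (1 : ℝ) 2) {x : ℝ} (hx : x ∈ Icc (0 : ℝ) 1) :
    (x, (0 : ℝ)) ∈ attractor β τ := by
  have hβ0 : 0 < β := by linarith [hβ.1]
  refine subset_closure (mem_iInter.2 fun i => ?_)
  induction i generalizing x with
  | zero => exact ⟨(x, 0), ⟨hx, by simp⟩, rfl⟩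
  | succ i ih =>
    have hle : x / β ≤ β⁻¹ := by
      rw [div_le_iff₀ hβ0, inv_mul_cancel₀ hβ0.ne']; exact hx.2
    obtain ⟨q, hq, he⟩ := ih (x := x / β)
      ⟨div_nonneg hx.1 hβ0.le, hle.trans (inv_le_one_of_one_le₀ hβ.1.le)⟩
    refine ⟨q, hq, ?_⟩
    rw [Function.iterate_succ_apply', he, bakerMap, if_pos hle]
    simp only [mul_div_cancel₀ _ hβ0.ne', mul_zero]

theorem bakerMap_iterate_sub {p q : ℝ × ℝ} {i : ℕ} (m : ℕ)
    (h : ∀ j, i ≤ j → j < i + m →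
      bakerDigit β ((bakerMap β τ)^[j] p) = bakerDigit β ((bakerMap β τ)^[j] q)) :
    (((bakerMap β τ)^[i + m] p).1 - ((bakerMap β τ)^[i + m] q).1 =
      β ^ m * (((bakerMap β τ)^[i] p).1 - ((bakerMap β τ)^[i] q).1)) ∧
    (((bakerMap β τ)^[i + m] p).2 - ((bakerMap β τ)^[i + m] q).2 =
      τ ^ m * (((bakerMap β τ)^[i] p).2 - ((bakerMap β τ)^[i] q).2)) := by
  induction m with
  | zero => simp
  | succ m ih =>
    obtain ⟨h1, h2⟩ := ih fun j hj hj' => h j hj (by omega)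
    have hd := h (i + m) (by omega) (by omega)
    rw [← add_assoc, Function.iterate_succ_apply', Function.iterate_succ_apply', bakerMap_eq,
      bakerMap_eq ((bakerMap β τ)^[i + m] q), hd]
    constructor
    · dsimp only
      rw [pow_succ']
      linear_combination β * h1
    · dsimp only
      rw [pow_succ']
      linear_combination τ * h2

theorem restrict_iterate_val {f : ℝ × ℝ → ℝ × ℝ} {s : Set (ℝ × ℝ)} (hf : MapsTo f s s) (n : ℕ)
    (p : s) : ((hf.restrict f s s)^[n] p).1 = f^[n] p.1 := by
  induction n with
  | zero => rfl
  | succ n ih => rw [Function.iterate_succ_apply', Function.iterate_succ_apply', ← ih]; rfl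

/-! ### Topological entropy of the attractor -/

theorem exists_subcover_of_labelling {X α : Type*} {V : Set (Set X)} (ℓ : X → α) (G : Finset α)
    (hG : ∀ x, ℓ x ∈ G) (hV : ∀ x₀, ∃ W ∈ V, ∀ x, ℓ x = ℓ x₀ → x ∈ W) :
    ∃ F : Finset (Set X), (F : Set (Set X)) ⊆ V ∧ ⋃₀ (F : Set (Set X)) = univ ∧
      F.card ≤ G.card := by
  classical
  choose W hWV hW using hV
  let G' := G.filter fun a => ∃ x, ℓ x = a
  -- The default ∅ is never selected: `G'` keeps only labels that are attained.
  let c : α → Set X := fun a => if h : ∃ x, ℓ x = a then W h.choose else ∅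
  have hc : ∀ x₀, c (ℓ x₀) ∈ V ∧ x₀ ∈ c (ℓ x₀) := by
    intro x₀
    have h : ∃ x, ℓ x = ℓ x₀ := ⟨x₀, rfl⟩
    have e : c (ℓ x₀) = W h.choose := dif_pos h
    rw [e]
    exact ⟨hWV _, hW _ _ h.choose_spec.symm⟩
  refine ⟨G'.image c, ?_, ?_, Finset.card_image_le.trans (Finset.card_filter_le _ _)⟩
  · intro A hA
    rw [Finset.mem_coe, Finset.mem_image] at hA
    obtain ⟨a, ha, rfl⟩ := hA
    obtain ⟨x, rfl⟩ := (Finset.mem_filter.1 ha).2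
    exact (hc x).1
  · refine eq_univ_of_forall fun x => ⟨c (ℓ x), ?_, (hc x).2⟩
    rw [Finset.mem_coe, Finset.mem_image]
    exact ⟨ℓ x, Finset.mem_filter.2 ⟨hG x, x, rfl⟩, rfl⟩

theorem iterate_mem_attractor (hf : MapsTo (bakerMap β τ) (attractor β τ) (attractor β τ))
    (p : attractor β τ) (i : ℕ) : (bakerMap β τ)^[i] p.1 ∈ unitSquare :=
  attractor_subset (hf.iterate i p.2)

theorem abs_sub_le_one {a b : ℝ} (ha : a ∈ Icc (0 : ℝ) 1) (hb : b ∈ Icc (0 : ℝ) 1) :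
    |a - b| ≤ 1 := by
  rw [abs_le]; constructor <;> linarith [ha.1, ha.2, hb.1, hb.2]

/-- Label a point by its first n + m branches and its height rounded to multiples of 1/M. Orbits
with equal labels stay within the Lebesgue number δ up to time n: the abscissas differ by at most
β⁻ᵐ, since their difference would otherwise exceed 1 after m more steps, and the heights, initially
within 1/M, only get closer. -/
theorem exists_subcover_coverJoin (hβ : β ∈ Ioo (1 : ℝ) 2) (hτ : τ ∈ Ioo (0 : ℝ) (1 / 2))
    (hf : MapsTo (bakerMap β τ) (attractor β τ) (attractor β τ))
    {U : Set (Set (attractor β τ))} (hU : ∀ u ∈ U, IsOpen u) (hUc : ⋃₀ U = univ) :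
    ∃ C : ℝ, 0 < C ∧ ∀ n, ∃ F : Finset (Set (attractor β τ)),
      (F : Set (Set (attractor β τ))) ⊆ coverJoin (hf.restrict _ _ _) U n ∧
      ⋃₀ (F : Set (Set (attractor β τ))) = univ ∧ (F.card : ℝ) ≤ C * β ^ n := by
  classical
  have hβ0 : 0 < β := by linarith [hβ.1]
  have hcomp : CompactSpace (attractor β τ) := isCompact_iff_compactSpace.1 isCompact_attractor
  obtain ⟨δ, hδ, hball⟩ := lebesgue_number_lemma_of_metric_sUnion isCompact_univ hU hUc.ge
  obtain ⟨m, hm⟩ := exists_pow_lt_of_lt_one hδ (inv_lt_one_of_one_lt₀ hβ.1)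
  obtain ⟨M, hM⟩ := exists_nat_gt δ⁻¹
  have hM0 : (0 : ℝ) < M := (inv_pos.2 hδ).trans hM
  obtain ⟨C, hC, hcount⟩ := exists_ncard_orbitWords_le hβ
  refine ⟨C * β ^ m * (M + 1), by positivity, fun n => ?_⟩
  let ℓ : attractor β τ → (Fin (n + m) → Fin 2) × ℕ := fun p =>
    (fun i => bakerDigit β ((bakerMap β τ)^[i] p.1), ⌊M * p.1.2⌋₊)
  have hfin := (orbitWords β (n + m) 1).toFinite
  let G := hfin.toFinset ×ˢ Finset.range (M + 1)
  have hG : ∀ p, ℓ p ∈ G := by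
    intro p
    rw [Finset.mem_product]
    constructor
    · rw [Finite.mem_toFinset]
      refine ⟨fun i => ((bakerMap β τ)^[i] p.1).1, (iterate_mem_attractor hf p 0).1.2,
        fun i _ => (iterate_mem_attractor hf p i).1, fun i => ?_⟩
      beta_reduce
      rw [Function.iterate_succ_apply', bakerMap_eq]
    · rw [Finset.mem_range, Nat.lt_succ_iff]
      refine Nat.floor_le_of_le ?_
      exact mul_le_of_le_one_right hM0.le (iterate_mem_attractor hf p 0).2.2
  obtain ⟨F, hF, hFc, hcard⟩ := exists_subcover_of_labelling
    (V := coverJoin (hf.restrict _ _ _) U n) ℓ G hG (by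
      intro p₀
      choose c hcU hc using fun i : Fin (n + 1) =>
        hball ((hf.restrict _ _ _)^[(i : ℕ)] p₀) (mem_univ _)
      refine ⟨_, ⟨c, hcU, rfl⟩, fun p hp => mem_iInter.2 fun i => hc i ?_⟩
      obtain ⟨hw, hfl⟩ := Prod.mk.inj hp
      have hdig : ∀ j < n + m, bakerDigit β ((bakerMap β τ)^[j] p.1) =
          bakerDigit β ((bakerMap β τ)^[j] p₀.1) := fun j hj => congrFun hw ⟨j, hj⟩
      rw [Metric.mem_ball, Subtype.dist_eq, restrict_iterate_val, restrict_iterate_val,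
        Prod.dist_eq, max_lt_iff, Real.dist_eq, Real.dist_eq]
      constructor
      · have h1 := (bakerMap_iterate_sub (τ := τ) (p := p.1) (q := p₀.1) (i := i) m
          fun j _ hj => hdig j (by omega)).1
        have h2 := abs_sub_le_one (iterate_mem_attractor hf p (i + m)).1
          (iterate_mem_attractor hf p₀ (i + m)).1
        rw [h1, abs_mul, abs_of_pos (by positivity)] at h2
        refine lt_of_le_of_lt ?_ hm
        rw [inv_pow, ← one_div, le_div_iff₀ (by positivity)]
        linarith
      · have h1 := (bakerMap_iterate_sub (τ := τ) (p := p.1) (q := p₀.1) (i := 0) i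
          fun j _ hj => hdig j (by omega)).2
        rw [zero_add] at h1
        rw [h1, Function.iterate_zero_apply, Function.iterate_zero_apply, abs_mul,
          abs_of_nonneg (pow_nonneg hτ.1.le _)]
        refine (mul_le_of_le_one_left (abs_nonneg _)
          (pow_le_one₀ hτ.1.le (by linarith [hτ.2]))).trans_lt ?_
        have hy0 : 0 ≤ M * p.1.2 := mul_nonneg hM0.le (iterate_mem_attractor hf p 0).2.1
        have hy0' : 0 ≤ M * p₀.1.2 := mul_nonneg hM0.le (iterate_mem_attractor hf p₀ 0).2.1
        have e1 := Nat.floor_le hy0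
        have e2 := Nat.lt_floor_add_one (M * p.1.2)
        have e3 := Nat.floor_le hy0'
        have e4 := Nat.lt_floor_add_one (M * p₀.1.2)
        rw [hfl] at e1 e2
        have e5 : M * |p.1.2 - p₀.1.2| < 1 := by
          calc M * |p.1.2 - p₀.1.2| = |M * (p.1.2 - p₀.1.2)| := by rw [abs_mul, abs_of_pos hM0]
            _ < 1 := by rw [abs_lt]; constructor <;> linarith
        have e6 : 1 < M * δ := by
          have := mul_lt_mul_of_pos_right hM hδ
          rwa [inv_mul_cancel₀ hδ.ne'] at this
        exact lt_of_mul_lt_mul_left (e5.trans e6) hM0.le)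
  refine ⟨F, hF, hFc, ?_⟩
  have hGc : G.card = (orbitWords β (n + m) 1).ncard * (M + 1) := by
    rw [Finset.card_product, Finset.card_range, ncard_eq_toFinset_card _ hfin]
  calc (F.card : ℝ) ≤ G.card := by exact_mod_cast hcard
    _ = (orbitWords β (n + m) 1).ncard * (M + 1) := by rw [hGc]; push_cast; ring
    _ ≤ C * β ^ (n + m) * (M + 1) := by gcongr; exact hcount _
    _ = C * β ^ m * (M + 1) * β ^ n := by rw [pow_add]; ring

theorem coverNumber_le {X : Type*} {V : Set (Set X)} {F : Finset (Set X)}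
    (hF : (F : Set (Set X)) ⊆ V) (hFc : ⋃₀ (F : Set (Set X)) = univ) : coverNumber V ≤ F.card :=
  Nat.sInf_le ⟨F, hF, hFc, rfl⟩

/-- Having one finite subcover excludes the default value 0 of the infimum of an empty set. -/
theorem exists_card_eq_coverNumber {X : Type*} {V : Set (Set X)} {F : Finset (Set X)}
    (hF : (F : Set (Set X)) ⊆ V) (hFc : ⋃₀ (F : Set (Set X)) = univ) :
    ∃ F : Finset (Set X), (F : Set (Set X)) ⊆ V ∧ ⋃₀ (F : Set (Set X)) = univ ∧
      F.card = coverNumber V :=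
  Nat.sInf_mem (s := {n : ℕ | ∃ F : Finset (Set X), (F : Set (Set X)) ⊆ V ∧
    ⋃₀ (F : Set (Set X)) = univ ∧ F.card = n}) ⟨_, F, hF, hFc, rfl⟩

theorem coverEntropyWrt_le (hβ : β ∈ Ioo (1 : ℝ) 2) (hτ : τ ∈ Ioo (0 : ℝ) (1 / 2))
    (hf : MapsTo (bakerMap β τ) (attractor β τ) (attractor β τ))
    {U : Set (Set (attractor β τ))} (hU : ∀ u ∈ U, IsOpen u) (hUc : ⋃₀ U = univ) :
    coverEntropyWrt (hf.restrict _ _ _) U ≤ Real.log β := by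
  have hβ0 : 0 < β := by linarith [hβ.1]
  obtain ⟨C, hC, H⟩ := exists_subcover_coverJoin hβ hτ hf hU hUc
  refine limsup_div_le (C := Real.log C) fun n => ?_
  obtain ⟨F, hF, hFc, hcard⟩ := H n
  obtain ⟨F', hF', hFc', hcard'⟩ := exists_card_eq_coverNumber hF hFc
  have hpos : 0 < coverNumber (coverJoin (hf.restrict _ _ _) U n) := by
    rw [← hcard', Finset.card_pos]
    by_contra hemp
    rw [Finset.not_nonempty_iff_eq_empty] at hemp
    rw [hemp, Finset.coe_empty, sUnion_empty] at hFc'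
    exact notMem_empty _ (hFc'.symm ▸ mem_univ
      (⟨(0, 0), segment_mem_attractor hβ (by simp)⟩ : attractor β τ))
  have hle : (coverNumber (coverJoin (hf.restrict _ _ _) U n) : ℝ) ≤ C * β ^ n :=
    le_trans (by exact_mod_cast coverNumber_le hF hFc) hcard
  refine (Real.log_le_log (by exact_mod_cast hpos) hle).trans (le_of_eq ?_)
  rw [Real.log_mul hC.ne' (by positivity), Real.log_pow]
  ring

/-- The cover of the attractor by balls of a radius that separates the two branches. -/
def separatingCover (β τ : ℝ) : Set (Set (attractor β τ)) :=
  range fun p => Metric.ball p ((1 - 2 * τ) / 2)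

/-- Images under different branches have heights in [0, τ] and [1 - τ, 1], at least 1 - 2τ apart. -/
theorem bakerDigit_eq_of_dist_lt {p q : ℝ × ℝ} (hτ0 : 0 < τ) (hp : p ∈ unitSquare)
    (hq : q ∈ unitSquare) (h : dist (bakerMap β τ p) (bakerMap β τ q) < 1 - 2 * τ) :
    bakerDigit β p = bakerDigit β q := by
  rw [Prod.dist_eq, max_lt_iff, Real.dist_eq, Real.dist_eq] at h
  have h2 := h.2
  simp only [bakerMap_eq] at h2
  obtain ⟨-, hy0, hy1⟩ := hp
  obtain ⟨-, hy0', hy1'⟩ := hq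
  rw [abs_lt] at h2
  rcases (show bakerDigit β p = 0 ∨ bakerDigit β p = 1 by
    generalize bakerDigit β p = d; fin_cases d <;> simp) with hd | hd <;>
  rcases (show bakerDigit β q = 0 ∨ bakerDigit β q = 1 by
    generalize bakerDigit β q = d; fin_cases d <;> simp) with hd' | hd' <;>
  rw [hd, hd'] at h2 ⊢ <;> exfalso <;> simp at h2 <;> nlinarith [h2.1, h2.2]

/-- Two points of the bottom edge in one element of the join stay less than 1 - 2τ apart up to time
n. Closeness at time j + 1 forces equal branches at time j, so their abscissas separate by the
factor βⁿ and were within β⁻ⁿ. Such slices must cover an interval of length 1. -/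
theorem pow_le_card_of_cover (hβ : β ∈ Ioo (1 : ℝ) 2) (hτ : τ ∈ Ioo (0 : ℝ) (1 / 2))
    (hf : MapsTo (bakerMap β τ) (attractor β τ) (attractor β τ)) {n : ℕ}
    {F : Finset (Set (attractor β τ))}
    (hF : (F : Set (Set (attractor β τ))) ⊆
      coverJoin (hf.restrict _ _ _) (separatingCover β τ) n)
    (hFc : ⋃₀ (F : Set (Set (attractor β τ))) = univ) : β ^ n ≤ F.card := by
  have hβ0 : 0 < β := by linarith [hβ.1]
  let S : Set (attractor β τ) → Set ℝ := fun W =>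
    {x | ∃ hx : x ∈ Icc (0 : ℝ) 1, (⟨(x, 0), segment_mem_attractor hβ hx⟩ : attractor β τ) ∈ W}
  have hcov : Icc (0 : ℝ) 1 ⊆ ⋃ W ∈ F, S W := by
    intro x hx
    obtain ⟨W, hW, hxW⟩ := hFc.symm ▸
      mem_univ (⟨(x, 0), segment_mem_attractor hβ hx⟩ : attractor β τ)
    exact mem_biUnion hW ⟨hx, hxW⟩
  have hvol : ∀ W ∈ F, volume (S W) ≤ ENNReal.ofReal (β⁻¹ ^ n) := by
    intro W hW
    obtain ⟨c, hc, rfl⟩ := hF hW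
    -- The diameter bounds the outer measure, so `S W` need not be measurable.
    refine (Real.volume_le_diam _).trans (Metric.ediam_le fun x hx y hy => ?_)
    obtain ⟨hx, hxW⟩ := hx
    obtain ⟨hy, hyW⟩ := hy
    set p : attractor β τ := ⟨(x, 0), segment_mem_attractor hβ hx⟩
    set q : attractor β τ := ⟨(y, 0), segment_mem_attractor hβ hy⟩
    have hdist : ∀ i ≤ n, dist ((bakerMap β τ)^[i] p.1) ((bakerMap β τ)^[i] q.1) < 1 - 2 * τ := by
      intro i hi
      have h1 := mem_iInter.1 hxW ⟨i, by omega⟩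
      have h2 := mem_iInter.1 hyW ⟨i, by omega⟩
      obtain ⟨r, hr⟩ := hc ⟨i, by omega⟩
      rw [mem_preimage, ← hr, Metric.mem_ball] at h1 h2
      rw [← restrict_iterate_val hf, ← restrict_iterate_val hf, ← Subtype.dist_eq]
      have := dist_triangle_right ((hf.restrict _ _ _)^[i] p) ((hf.restrict _ _ _)^[i] q) r
      dsimp only at h1 h2
      linarith
    have hsub := (bakerMap_iterate_sub (β := β) (τ := τ) (p := p.1) (q := q.1) (i := 0) n
      fun j _ hj => bakerDigit_eq_of_dist_lt hτ.1 (iterate_mem_attractor hf p j)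
        (iterate_mem_attractor hf q j) (by
          rw [← Function.iterate_succ_apply' (bakerMap β τ),
            ← Function.iterate_succ_apply' (bakerMap β τ)]
          exact hdist _ (by omega))).1
    rw [zero_add] at hsub
    have h2 := abs_sub_le_one (iterate_mem_attractor hf p n).1 (iterate_mem_attractor hf q n).1
    rw [hsub, abs_mul, abs_of_pos (by positivity)] at h2
    change β ^ n * |x - y| ≤ 1 at h2
    rw [edist_dist, Real.dist_eq]
    refine ENNReal.ofReal_le_ofReal ?_
    rw [inv_pow, ← one_div, le_div_iff₀ (by positivity)]
    linarith
  have h1 : (1 : ENNReal) ≤ F.card * ENNReal.ofReal (β⁻¹ ^ n) := by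
    calc (1 : ENNReal) = volume (Icc (0 : ℝ) 1) := by simp
      _ ≤ volume (⋃ W ∈ F, S W) := measure_mono hcov
      _ ≤ ∑ W ∈ F, volume (S W) := measure_biUnion_finset_le _ _
      _ ≤ ∑ _W ∈ F, ENNReal.ofReal (β⁻¹ ^ n) := Finset.sum_le_sum hvol
      _ = F.card * ENNReal.ofReal (β⁻¹ ^ n) := by rw [Finset.sum_const, nsmul_eq_mul]
  have h2 := ENNReal.toReal_mono
    (ENNReal.mul_ne_top (ENNReal.natCast_ne_top _) ENNReal.ofReal_ne_top) h1
  rw [ENNReal.toReal_one, ENNReal.toReal_mul, ENNReal.toReal_natCast,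
    ENNReal.toReal_ofReal (by positivity), inv_pow, ← div_eq_mul_inv,
    le_div_iff₀ (by positivity), one_mul] at h2
  exact h2

theorem topologicalEntropy_eq (hβ : β ∈ Ioo (1 : ℝ) 2) (hτ : τ ∈ Ioo (0 : ℝ) (1 / 2))
    (hf : MapsTo (bakerMap β τ) (attractor β τ) (attractor β τ)) :
    topologicalEntropy (hf.restrict _ _ _) = Real.log β := by
  refine le_antisymm (iSup₂_le fun U hU => coverEntropyWrt_le hβ hτ hf hU.1 hU.2) ?_
  have hr : 0 < (1 - 2 * τ) / 2 := by linarith [hτ.2]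
  have hopen : ∀ u ∈ separatingCover β τ, IsOpen u := by
    rintro _ ⟨p, rfl⟩
    exact Metric.isOpen_ball
  have hcov : ⋃₀ separatingCover β τ = univ :=
    eq_univ_of_forall fun p => ⟨_, ⟨p, rfl⟩, Metric.mem_ball_self hr⟩
  refine le_trans ?_ (le_iSup₂_of_le (separatingCover β τ) ⟨hopen, hcov⟩ le_rfl)
  obtain ⟨C, -, H⟩ := exists_subcover_coverJoin hβ hτ hf hopen hcov
  refine le_limsup_div (C := 0) fun n => ?_
  obtain ⟨F, hF, hFc, -⟩ := H n
  obtain ⟨F', hF', hFc', hcard'⟩ := exists_card_eq_coverNumber hF hFc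
  have h := pow_le_card_of_cover hβ hτ hf hF' hFc'
  rw [hcard'] at h
  have hβ0 : 0 < β := by linarith [hβ.1]
  rw [add_zero, ← Real.log_pow]
  exact Real.log_le_log (by positivity) h

end Attractor

/-! ### Factors -/

section Factor

variable {X Y : Type*} [MeasurableSpace X] [MeasurableSpace Y] {μ : Measure X} {ν : Measure Y}
  {T : X → X} {S : Y → Y} {g : X → Y}

theorem measurePreserving_of_factor (hT : MeasurePreserving T μ μ) (hS : Measurable S)
    (hg : MeasurePreserving g μ ν) (h : ∀ᵐ x ∂μ, g (T x) = S (g x)) :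
    MeasurePreserving S ν ν := by
  refine ⟨hS, ?_⟩
  have h' : S ∘ g =ᵐ[μ] g ∘ T := h.mono fun x hx => hx.symm
  rw [← hg.map_eq, Measure.map_map hS hg.measurable, Measure.map_congr h',
    ← Measure.map_map hg.measurable hT.measurable, hT.map_eq]

/-- The semiconjugacy holds only almost everywhere, so the pull-back of an invariant set is
invariant only modulo null sets; quasi-ergodicity still applies. -/
theorem ergodic_of_factor (hT : Ergodic T μ) (hS : Measurable S)
    (hg : MeasurePreserving g μ ν) (h : ∀ᵐ x ∂μ, g (T x) = S (g x)) : Ergodic S ν := by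
  refine ⟨measurePreserving_of_factor hT.toMeasurePreserving hS hg h, ⟨fun A hA hinv => ?_⟩⟩
  have hpre : T ⁻¹' (g ⁻¹' A) =ᵐ[μ] g ⁻¹' A := by
    filter_upwards [h] with x hx
    have : S (g x) ∈ A ↔ g x ∈ A := by
      change g x ∈ S ⁻¹' A ↔ _
      rw [hinv]
    exact propext (by change g (T x) ∈ A ↔ g x ∈ A; rw [hx, this])
  have := hT.quasiErgodic.aeconst_set₀ (hg.measurable hA).nullMeasurableSet hpre
  rw [eventuallyConst_set'] at this ⊢
  rcases this with h0 | h0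
  · left
    rw [ae_eq_empty, hg.measure_preimage hA.nullMeasurableSet] at h0
    exact ae_eq_empty.2 h0
  · right
    rw [ae_eq_univ, ← preimage_compl, hg.measure_preimage hA.compl.nullMeasurableSet] at h0
    exact ae_eq_univ.2 h0

theorem ae_iterate_of_factor {Z : Type*} {g : X → Z} {S : Z → Z} (hT : MeasurePreserving T μ μ)
    (h : ∀ᵐ x ∂μ, g (T x) = S (g x)) (n : ℕ) : ∀ᵐ x ∂μ, g (T^[n] x) = S^[n] (g x) := by
  induction n with
  | zero => simp
  | succ n ih =>
    filter_upwards [ih, (hT.iterate n).quasiMeasurePreserving.ae h] with x hx hx'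
    rw [Function.iterate_succ_apply', Function.iterate_succ_apply', hx', hx]

theorem metricEntropyWrt_congr {ι : Type*} [Fintype ι] (hT : MeasurePreserving T μ μ)
    {p q : X → ι} (h : p =ᵐ[μ] q) : metricEntropyWrt T μ p = metricEntropyWrt T μ q := by
  unfold metricEntropyWrt
  have : ∀ n, partitionEntropy μ (itinerary T p n) = partitionEntropy μ (itinerary T q n) := by
    intro n
    refine partitionEntropy_congr ?_
    have hall : ∀ᵐ x ∂μ, ∀ i : Fin (n + 1), p (T^[(i : ℕ)] x) = q (T^[(i : ℕ)] x) :=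
      ae_all_iff.2 fun i => (hT.iterate i).quasiMeasurePreserving.ae h
    filter_upwards [hall] with x hx
    exact funext hx
  simp_rw [this]

theorem metricEntropyWrt_factor {ι : Type*} [Fintype ι] (hT : MeasurePreserving T μ μ)
    (hS : Measurable S) (hg : MeasurePreserving g μ ν) (h : ∀ᵐ x ∂μ, g (T x) = S (g x))
    {p : Y → ι} (hp : ∀ a, MeasurableSet (p ⁻¹' {a})) :
    metricEntropyWrt S ν p = metricEntropyWrt T μ (p ∘ g) := by
  unfold metricEntropyWrt
  have : ∀ n, partitionEntropy ν (itinerary S p n) =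
      partitionEntropy μ (itinerary T (p ∘ g) n) := by
    intro n
    rw [← partitionEntropy_comp_measurePreserving hg (measurableSet_itinerary_preimage hS hp n)]
    refine partitionEntropy_congr ?_
    have hall : ∀ᵐ x ∂μ, ∀ i : Fin (n + 1), g (T^[(i : ℕ)] x) = S^[(i : ℕ)] (g x) :=
      ae_all_iff.2 fun i => ae_iterate_of_factor hT h i
    filter_upwards [hall] with x hx
    funext i
    exact congrArg p (hx i).symm
  simp_rw [this]

theorem metricEntropy_factor_le (hT : MeasurePreserving T μ μ)
    (hS : Measurable S) (hg : MeasurePreserving g μ ν) (h : ∀ᵐ x ∂μ, g (T x) = S (g x)) :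
    metricEntropy S ν ≤ metricEntropy T μ := by
  refine iSup_le fun k => iSup_le fun p => iSup_le fun hp => ?_
  rw [metricEntropyWrt_factor hT hS hg h fun a => hp (measurableSet_singleton a)]
  exact le_iSup_of_le k (le_iSup_of_le (p ∘ g) (le_iSup_of_le (hp.comp hg.measurable) le_rfl))

end Factor

/-! ### The coding map -/

section Coding

variable {β τ : ℝ}

/-- The value `∑ u_k β^{-k-1}` of a one-sided sequence of digits. -/
def digitValue (β : ℝ) (u : ℕ → Fin 2) : ℝ := ∑' k : ℕ, ((u k : ℕ) : ℝ) * β⁻¹ ^ (k + 1)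

theorem coe_fin_two_le_one (d : Fin 2) : ((d : ℕ) : ℝ) ≤ 1 := by
  have : (d : ℕ) ≤ 1 := by omega
  exact_mod_cast this

theorem continuous_coe_fin_two : Continuous fun d : Fin 2 => ((d : ℕ) : ℝ) :=
  continuous_of_discreteTopology

theorem summable_inv_pow_succ (hβ : β ∈ Ioo (1 : ℝ) 2) : Summable fun k : ℕ => β⁻¹ ^ (k + 1) := by
  have hβ0 : 0 < β := by linarith [hβ.1]
  exact (summable_nat_add_iff 1).2
    (summable_geometric_of_lt_one (by positivity) (inv_lt_one_of_one_lt₀ hβ.1))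

theorem norm_digit_mul_le (d : Fin 2) {c : ℝ} (hc : 0 ≤ c) : ‖((d : ℕ) : ℝ) * c‖ ≤ c := by
  rw [Real.norm_of_nonneg (by positivity)]
  exact mul_le_of_le_one_left hc (coe_fin_two_le_one d)

theorem summable_digitValue (hβ : β ∈ Ioo (1 : ℝ) 2) (u : ℕ → Fin 2) :
    Summable fun k : ℕ => ((u k : ℕ) : ℝ) * β⁻¹ ^ (k + 1) := by
  have hβ0 : 0 < β := by linarith [hβ.1]
  exact Summable.of_norm_bounded (summable_inv_pow_succ hβ)
    fun k => norm_digit_mul_le _ (by positivity)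

theorem continuous_digitValue (hβ : β ∈ Ioo (1 : ℝ) 2) : Continuous (digitValue β) := by
  have hβ0 : 0 < β := by linarith [hβ.1]
  refine continuous_tsum (fun k => ?_) (summable_inv_pow_succ hβ)
    fun k u => norm_digit_mul_le _ (by positivity)
  exact (continuous_coe_fin_two.comp (continuous_apply k)).mul continuous_const

theorem hasSum_one_sub_mul_pow (hτ : τ ∈ Ioo (0 : ℝ) (1 / 2)) :
    HasSum (fun k : ℕ => (1 - τ) * τ ^ k) 1 := by
  have h1 : τ < 1 := by linarith [hτ.2]
  have := (hasSum_geometric_of_lt_one hτ.1.le h1).mul_left (1 - τ)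
  rwa [mul_inv_cancel₀ (by linarith)] at this

theorem weight_nonneg (hτ : τ ∈ Ioo (0 : ℝ) (1 / 2)) (k : ℕ) : 0 ≤ (1 - τ) * τ ^ k :=
  mul_nonneg (by linarith [hτ.2]) (pow_nonneg hτ.1.le k)

theorem summable_vertical (hτ : τ ∈ Ioo (0 : ℝ) (1 / 2)) (u : ℕ → Fin 2) :
    Summable fun k : ℕ => ((u k : ℕ) : ℝ) * (1 - τ) * τ ^ k := by
  simp_rw [mul_assoc]
  exact Summable.of_norm_bounded (hasSum_one_sub_mul_pow hτ).summable
    fun k => norm_digit_mul_le _ (weight_nonneg hτ k)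

theorem continuous_coding (hβ : β ∈ Ioo (1 : ℝ) 2) (hτ : τ ∈ Ioo (0 : ℝ) (1 / 2)) :
    Continuous (coding β τ) := by
  have hβ0 : 0 < β := by linarith [hβ.1]
  refine Continuous.prodMk ?_ ?_
  · refine continuous_tsum (fun k => ?_) (summable_inv_pow_succ hβ)
      fun k u => norm_digit_mul_le _ (by positivity)
    exact (continuous_coe_fin_two.comp (continuous_apply (-((k : ℤ) + 1)))).mul continuous_const
  · simp_rw [mul_assoc]
    refine continuous_tsum (fun k => ?_) (hasSum_one_sub_mul_pow hτ).summable
      fun k u => norm_digit_mul_le _ (weight_nonneg hτ k)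
    exact (continuous_coe_fin_two.comp (continuous_apply (k : ℤ))).mul continuous_const

theorem coding_fst (s : ℤ → Fin 2) : (coding β τ s).1 = digitValue β (past 0 s) := by
  simp [coding, digitValue, past]

theorem coding_snd_mem (hτ : τ ∈ Ioo (0 : ℝ) (1 / 2)) (s : ℤ → Fin 2) :
    (coding β τ s).2 ∈ Icc (0 : ℝ) 1 := by
  constructor
  · refine tsum_nonneg fun k => ?_
    rw [mul_assoc]
    exact mul_nonneg (Nat.cast_nonneg _) (weight_nonneg hτ k)
  · rw [← (hasSum_one_sub_mul_pow hτ).tsum_eq]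
    refine (summable_vertical hτ fun k => s k).tsum_le_tsum (fun k => ?_)
      (hasSum_one_sub_mul_pow hτ).summable
    rw [mul_assoc]
    exact mul_le_of_le_one_left (weight_nonneg hτ k) (coe_fin_two_le_one _)

/-- The shift moves the symbol at -1 from the front of the horizontal series to the front of the
vertical one. This holds for every s, and it is the baker map as soon as that symbol is the branch
used at the coded point. -/
theorem coding_shift (hβ : β ∈ Ioo (1 : ℝ) 2) (hτ : τ ∈ Ioo (0 : ℝ) (1 / 2)) (s : ℤ → Fin 2) :
    coding β τ (shift s) = (β * (coding β τ s).1 - ((s (-1) : ℕ) : ℝ),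
      τ * (coding β τ s).2 + ((s (-1) : ℕ) : ℝ) * (1 - τ)) := by
  have hβ0 : 0 < β := by linarith [hβ.1]
  have e1 : (coding β τ (shift s)).1 = β * (coding β τ s).1 - ((s (-1) : ℕ) : ℝ) := by
    have h := (summable_digitValue hβ fun k => s (-((k : ℤ) + 1))).tsum_eq_zero_add
    have h' : (coding β τ (shift s)).1 = β * ∑' k : ℕ,
        ((s (-(((k + 1 : ℕ) : ℤ) + 1)) : ℕ) : ℝ) * β⁻¹ ^ (k + 1 + 1) := by
      rw [← tsum_mul_left]
      refine tsum_congr fun k => ?_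
      have : shift s (-((k : ℤ) + 1)) = s (-(((k + 1 : ℕ) : ℤ) + 1)) :=
        congrArg s (by push_cast; ring)
      rw [this, pow_succ β⁻¹ (k + 1)]
      field_simp
    have h0 : (coding β τ s).1 = ((s (-1) : ℕ) : ℝ) * β⁻¹ + ∑' k : ℕ,
        ((s (-(((k + 1 : ℕ) : ℤ) + 1)) : ℕ) : ℝ) * β⁻¹ ^ (k + 1 + 1) := by
      refine h.trans ?_
      simp
    rw [h', h0]
    field_simp
    ring
  have e2 : (coding β τ (shift s)).2 = τ * (coding β τ s).2 + ((s (-1) : ℕ) : ℝ) * (1 - τ) := by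
    have h := (summable_vertical hτ fun k => shift s k).tsum_eq_zero_add
    have h' : (coding β τ (shift s)).2 = ((s (-1) : ℕ) : ℝ) * (1 - τ) + ∑' k : ℕ,
        ((shift s ((k + 1 : ℕ) : ℤ) : ℕ) : ℝ) * (1 - τ) * τ ^ (k + 1) := by
      refine h.trans ?_
      simp [shift]
    have h0 : τ * (coding β τ s).2 = ∑' k : ℕ,
        ((shift s ((k + 1 : ℕ) : ℤ) : ℕ) : ℝ) * (1 - τ) * τ ^ (k + 1) := by
      rw [coding, ← tsum_mul_left]
      refine tsum_congr fun k => ?_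
      have : shift s ((k + 1 : ℕ) : ℤ) = s k := congrArg s (by push_cast; ring)
      rw [this]; ring
    rw [h', h0, add_comm]
  exact Prod.ext e1 e2

variable {μ : Measure (betaShift β)}

/-- The greedy digit is 0 for x < β⁻¹, the left branch is used for x ≤ β⁻¹, and the single
exceptional point has measure zero. -/
theorem IsParryMeasure.ae_digitValue (hβ : β ∈ Ioo (1 : ℝ) 2) (h : IsParryMeasure β μ) :
    ∀ᵐ s ∂μ, digitValue β (past 0 s.1) ∈ Ico (0 : ℝ) 1 ∧
      (past 0 s.1 0 = 0 ↔ digitValue β (past 0 s.1) ≤ β⁻¹) := by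
  have hβ0 : 0 < β := by linarith [hβ.1]
  have hm := (continuous_digitValue hβ).measurable
  have hE : MeasurableSet {u : ℕ → Fin 2 | digitValue β u ∈ Ico (0 : ℝ) 1 ∧
      (u 0 = 0 ↔ digitValue β u ≤ β⁻¹)} := by
    refine (hm measurableSet_Ico).inter (MeasurableSet.iff ?_ (hm measurableSet_Iic))
    exact measurableSet_eq_fun (measurable_pi_apply 0) measurable_const
  refine h.ae_past hE ?_
  have hne : ∀ᵐ x ∂parryInterval β, x ≠ β⁻¹ := by
    rw [ae_iff]
    simpa using parryInterval_singleton (β := β) β⁻¹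
  filter_upwards [ae_mem_Ico_parryInterval, hne] with x hx hx'
  have e : digitValue β (betaDigits β x) = x :=
    (hasSum_betaDigits hβ (Ico_subset_Icc_self hx)).tsum_eq
  refine ⟨by rwa [e], ?_⟩
  rw [e, betaDigits_zero_eq_zero, ← lt_inv_mul_iff₀ hβ0, mul_one]
  exact ⟨le_of_lt, fun hle => lt_of_le_of_ne hle hx'⟩

theorem IsParryMeasure.ae_bakerDigit_coding (hβ : β ∈ Ioo (1 : ℝ) 2) (τ : ℝ)
    (h : IsParryMeasure β μ) : ∀ᵐ s ∂μ, bakerDigit β (coding β τ s.1) = s.1 (-1) := by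
  filter_upwards [h.ae_digitValue hβ] with s hs
  have e : past 0 s.1 0 = s.1 (-1) := by simp [past]
  rw [bakerDigit, coding_fst]
  have h2 := hs.2
  rw [e] at h2
  split_ifs with hle
  · exact (h2.2 hle).symm
  · have := mt h2.1 hle
    omega

theorem IsParryMeasure.ae_coding_shift (hβ : β ∈ Ioo (1 : ℝ) 2) (hτ : τ ∈ Ioo (0 : ℝ) (1 / 2))
    (h : IsParryMeasure β μ) :
    ∀ᵐ s ∂μ, coding β τ (betaShiftMap β s).1 = bakerMap β τ (coding β τ s.1) := by
  filter_upwards [h.ae_bakerDigit_coding hβ τ] with s hs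
  rw [bakerMap_eq, hs]
  exact coding_shift hβ hτ s.1

theorem measurable_bakerMap (β τ : ℝ) : Measurable (bakerMap β τ) := by
  refine Measurable.ite (measurableSet_le measurable_fst measurable_const) ?_ ?_ <;> fun_prop

theorem injOn_bakerMap (hβ : β ∈ Ioo (1 : ℝ) 2) (hτ : τ ∈ Ioo (0 : ℝ) (1 / 2)) :
    InjOn (bakerMap β τ) unitSquare := by
  have hβ0 : 0 < β := by linarith [hβ.1]
  intro p hp q hq he
  have hd := bakerDigit_eq_of_dist_lt (β := β) hτ.1 hp hq
    (by rw [he, dist_self]; linarith [hτ.2])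
  rw [bakerMap_eq, bakerMap_eq q, hd, Prod.mk.injEq] at he
  refine Prod.ext (mul_left_cancel₀ hβ0.ne' ?_) (mul_left_cancel₀ hτ.1.ne' ?_)
  · linarith [he.1]
  · linarith [he.2]

/-- The image measure is invariant under the baker map and carried by the square, hence by each of
the countably many forward images of the square. -/
theorem IsParryMeasure.ae_coding_mem_attractor (hβ : β ∈ Ioo (1 : ℝ) 2)
    (hτ : τ ∈ Ioo (0 : ℝ) (1 / 2)) [IsProbabilityMeasure μ] (h : IsParryMeasure β μ) :
    ∀ᵐ s ∂μ, coding β τ s.1 ∈ attractor β τ := by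
  have hcm : Measurable fun s : betaShift β => coding β τ s.1 :=
    (continuous_coding hβ hτ).measurable.comp measurable_subtype_coe
  have hg : MeasurePreserving (fun s : betaShift β => coding β τ s.1) μ
    (μ.map fun s => coding β τ s.1) := ⟨hcm, rfl⟩
  have hinv := measurePreserving_of_factor h.invariant (measurable_bakerMap β τ) hg
    (h.ae_coding_shift hβ hτ)
  have hsq : MeasurableSet unitSquare := isClosed_unitSquare.measurableSet
  have hmem : ∀ᵐ p ∂(μ.map fun s => coding β τ s.1), p ∈ unitSquare := by
    rw [ae_map_iff (p := (· ∈ unitSquare)) hcm.aemeasurable hsq]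
    filter_upwards [h.ae_digitValue hβ] with s hs
    refine ⟨?_, coding_snd_mem hτ s.1⟩
    rw [coding_fst]
    exact Ico_subset_Icc_self hs.1
  have himg : ∀ i : ℕ, ∀ᵐ p ∂(μ.map fun s => coding β τ s.1),
      p ∈ (bakerMap β τ)^[i] '' unitSquare := by
    intro i
    -- Injectivity on the square makes the forward images Borel.
    have hmi : MeasurableSet ((bakerMap β τ)^[i] '' unitSquare) :=
      hsq.image_of_measurable_injOn ((measurable_bakerMap β τ).iterate i)
        ((injOn_bakerMap hβ hτ).iterate (fun p hp => bakerMap_mem_unitSquare hβ hτ hp) i)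
    rw [← (hinv.iterate i).map_eq,
      ae_map_iff (p := (· ∈ (bakerMap β τ)^[i] '' unitSquare)) (hinv.iterate i).aemeasurable hmi]
    filter_upwards [hmem] with p hp
    exact ⟨p, hp, rfl⟩
  have hall : ∀ᵐ p ∂(μ.map fun s => coding β τ s.1), p ∈ attractor β τ := by
    filter_upwards [ae_all_iff.2 himg] with p hp
    exact subset_closure (mem_iInter.2 hp)
  exact ae_of_ae_map hcm.aemeasurable hall

end Coding

open Classical in
/-- The coding map as a map to the attractor; outside it, the value is irrelevant. -/
def codingAttractor {β : ℝ} (hβ : β ∈ Ioo (1 : ℝ) 2) (τ : ℝ) (s : betaShift β) : attractor β τ :=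
  if h : coding β τ s.1 ∈ attractor β τ then ⟨_, h⟩
  else ⟨(0, 0), segment_mem_attractor hβ ⟨le_rfl, zero_le_one⟩⟩

theorem measurable_codingAttractor {β τ : ℝ} (hβ : β ∈ Ioo (1 : ℝ) 2)
    (hτ : τ ∈ Ioo (0 : ℝ) (1 / 2)) : Measurable (codingAttractor hβ τ) := by
  classical
  have hcm : Measurable fun s : betaShift β => coding β τ s.1 :=
    (continuous_coding hβ hτ).measurable.comp measurable_subtype_coe
  have hm : Measurable fun s : betaShift β =>
      if coding β τ s.1 ∈ attractor β τ then coding β τ s.1 else (0, 0) :=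
    Measurable.ite (hcm isClosed_closure.measurableSet) hcm measurable_const
  have e : (fun s => (codingAttractor hβ τ s).1) = fun s : betaShift β =>
      if coding β τ s.1 ∈ attractor β τ then coding β τ s.1 else (0, 0) := by
    funext s
    unfold codingAttractor
    split_ifs <;> rfl
  have hm' : Measurable fun s => (codingAttractor hβ τ s).1 := by rw [e]; exact hm
  exact hm'.subtype_mk (h := fun s => (codingAttractor hβ τ s).2)

theorem codingAttractor_val {β τ : ℝ} (hβ : β ∈ Ioo (1 : ℝ) 2) {s : betaShift β}
    (h : coding β τ s.1 ∈ attractor β τ) : (codingAttractor hβ τ s).1 = coding β τ s.1 := by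
  rw [codingAttractor, dif_pos h]

end

end BetaAttractor

/-! ### Assembly of the theorem -/

open BetaAttractor

theorem mainTheorem2 (β τ : ℝ) (hβ : β ∈ Set.Ioo (1 : ℝ) 2) (hτ : τ ∈ Set.Ioo (0 : ℝ) (1 / 2)) :
    ∃ hf : Set.MapsTo (BetaAttractor.bakerMap β τ) (BetaAttractor.attractor β τ)
        (BetaAttractor.attractor β τ),
      BetaAttractor.topologicalEntropy (hf.restrict _ _ _) = ((Real.log β : ℝ) : EReal) ∧
      ∃ (μ : MeasureTheory.Measure (BetaAttractor.betaShift β))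
        (ν : MeasureTheory.Measure (BetaAttractor.attractor β τ)),
        BetaAttractor.IsParryMeasure β μ ∧
        MeasureTheory.IsProbabilityMeasure μ ∧
        Ergodic (BetaAttractor.betaShiftMap β) μ ∧
        BetaAttractor.metricEntropy (BetaAttractor.betaShiftMap β) μ =
          ((Real.log β : ℝ) : EReal) ∧
        -- `ν` is the image of `μ` under the coding map
        ν.map Subtype.val = μ.map (fun s => BetaAttractor.coding β τ s.1) ∧
        MeasureTheory.IsProbabilityMeasure ν ∧
        Ergodic (hf.restrict _ _ _) ν ∧
        BetaAttractor.metricEntropy (hf.restrict _ _ _) ν = ((Real.log β : ℝ) : EReal) := by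
  have hf := mapsTo_attractor hβ hτ
  obtain ⟨μ, hμ, hprob⟩ := exists_isParryMeasure hβ
  have hcm := measurable_codingAttractor hβ hτ
  have hmem := hμ.ae_coding_mem_attractor hβ hτ
  have hg : MeasurePreserving (codingAttractor hβ τ) μ (μ.map (codingAttractor hβ τ)) :=
    ⟨hcm, rfl⟩
  have hS : Measurable (hf.restrict (bakerMap β τ) (attractor β τ) (attractor β τ)) :=
    ((measurable_bakerMap β τ).comp measurable_subtype_coe).subtype_mk
  have hsem : ∀ᵐ s ∂μ, codingAttractor hβ τ (betaShiftMap β s) =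
      hf.restrict (bakerMap β τ) (attractor β τ) (attractor β τ) (codingAttractor hβ τ s) := by
    filter_upwards [hmem, hμ.invariant.quasiMeasurePreserving.ae hmem,
      hμ.ae_coding_shift hβ hτ] with s h1 h2 h3
    refine Subtype.ext ?_
    rw [codingAttractor_val hβ h2, h3, Set.MapsTo.val_restrict_apply, codingAttractor_val hβ h1]
  refine ⟨hf, topologicalEntropy_eq hβ hτ hf, μ, μ.map (codingAttractor hβ τ), hμ, hprob,
    hμ.ergodic hβ, hμ.metricEntropy_eq hβ, ?_, Measure.isProbabilityMeasure_map hcm.aemeasurable,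
    ergodic_of_factor (hμ.ergodic hβ) hS hg hsem, le_antisymm ?_ ?_⟩
  · rw [Measure.map_map measurable_subtype_coe hcm]
    refine Measure.map_congr ?_
    filter_upwards [hmem] with s hs
    exact codingAttractor_val hβ hs
  · rw [← hμ.metricEntropy_eq hβ]
    exact metricEntropy_factor_le hμ.invariant hS hg hsem
  · have hp : Measurable fun p : attractor β τ => bakerDigit β p.1 :=
      Measurable.ite (measurableSet_le (measurable_fst.comp measurable_subtype_coe)
        measurable_const) measurable_const measurable_const
    -- Coding followed by the branch partition is almost surely the time-zero partition of the
    -- shift, so the entropy of the latter is a lower bound for the image measure.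
    have hae : (fun p : attractor β τ => bakerDigit β p.1) ∘ codingAttractor hβ τ =ᵐ[μ]
        fun s => s.1 (-1) := by
      filter_upwards [hmem, hμ.ae_bakerDigit_coding hβ τ] with s hs hs'
      rw [Function.comp, codingAttractor_val hβ hs, hs']
    refine (hμ.log_le_metricEntropyWrt hβ).trans ?_
    rw [← metricEntropyWrt_congr hμ.invariant hae, ← metricEntropyWrt_factor hμ.invariant hS hg hsem
      fun a => hp (measurableSet_singleton a)]
    exact le_iSup_of_le 2 (le_iSup_of_le _ (le_iSup_of_le hp le_rfl))
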